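/- **Setting.** Fix a finite alphabet $\mathbb A$, a countable set $\mathcal Q$ of properties (say $\mathcal Q=\mathbb N$), and a set $\Pi$ of regular expressions over $\mathbb A$ (built from the words $d\in\mathbb A^*$ by concatenation, union and star). *Trees* are the elements of the least set containing every finite multiset $\{d_1:t_1,\dots,d_n:t_n\}$, $n\ge 0$, with $d_i\in\mathbb A^*$ and $t_i$ trees. *Filters* are given by $\varphi ::= \pi\mid q\mid \varphi\wedge\varphi\mid\neg\varphi$ with $\pi\in\Pi$, $q\in\mathcal Q$; for $d\in\mathbb A^*$ and $Q\subseteq\mathcal Q$, $(d,Q)\models\pi$ iff $d$ matches $\pi$, $(d,Q)\models q$ iff $q\in Q$, and $\wedge,\neg$ are as usual. A filter is *singleton-valid* if it is satisfied by all $(d,Q)$ with $|Q|\le 1$. A *horizontal automaton* $H$ consists of a finite set $P$ of horizontal states and a finite set of transitions $p\xrightarrow{\varphi}p'$ with $p,p'\in P$ and $\varphi$ a filter. It rewrites pairs of a state and a finite multiset over $\mathbb A^*\times 2^{\mathcal Q}$: $(p,M+\{d:Q\})\to(p',M)$ if there is a transition $p\xrightarrow{\varphi}p'$ with $(d,Q)\models\varphi$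 (one says that $p$ *can read* $(d,Q)$). $H$ is *confluent* if the relation obtained from $\to$ by adding $(p,M)\to\bot$ whenever $M\neq\emptyset$ and $(p,M)$ has no $\to$-successor is confluent. An *AUTC* $A$ consists of a confluent horizontal automaton $H$, an initial state $p_0\in P$, a finite set $S\subseteq\mathcal Q$ of vertical states, a set $F\subseteq S$ of final states, and a finite set of rules $(p_0,p)\to q$ with $p\in P$, $q\in S$, such that whether $(p_0,\{d_1:Q_1,\dots,d_n:Q_n\})\to^*(p,\emptyset)$ holds depends, for each rule, only on the sets $Q_i\cap S$, and such that $A$ is vertically deterministic: every tree is evaluated to at most one state. Here the evaluation of a tree is the set of states defined recursively by $$\mathrm{eval}_A\{d_1:t_1,\dots,d_n:t_n\}=\{q \mid \text{there is a rule } (p_0,p)\to q \text{ with } (p_0,\{d_1:\mathrm{eval}_A(t_1),\dots,d_n:\mathrm{eval}_A(t_n)\})\to^*(p,\emptyset)\},$$ and $L(A)=\{t\mid \mathrm{eval}_A(t)\cap F\ne\emptyset\}$. A vertical state $q$ is *accessible* if $q\in\mathrm{eval}_A(t)$ for some tree $t$, and *accepting* if $q\in F$. A horizontal state $p$ is *accessible*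 if $(p_0,M)\to^*(p,\emptyset)$ for some finite multiset $M$ of pairs $(d,\{q\})$ with $d\in\mathbb A^*$ and $q$ an accessible vertical state, and *accepting* if there is a rule $(p_0,p)\to q$ for some $q$. **Proposition (AUTC Universality).** Suppose that singleton-validity of filters is decidable in polynomial time. Then it is decidable in polynomial time, given an AUTC $A$, whether $L(A)$ is the set of all trees. (Filters and automata are written as strings in the usual way, with state names in binary, and polynomial time is that of deterministic multi-stack Turing machines, in the length of the input. Inputs are promised to be filters, respectively AUTCs.) Moreover, for every AUTC $A$, $L(A)$ is the set of all trees if and only if every accessible vertical state is accepting, every accessible horizontal state is accepting, and every accessible horizontal state can read $(d,\{q\})$ for every $d\in\mathbb A^*$ and every accessible vertical state $q$. -/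

import Mathlib

namespace DataTree

/-! ### Unordered, edge-labelled data trees -/

/-- Finite trees whose edges carry data values in `α*`, with an (irrelevant) order on the edges
below each node. -/
inductive OrdTree (α : Type) : Type
  | node (children : List (List α × OrdTree α)) : OrdTree α

/-- One reordering step: permute the edges below the root, or reorder inside one subtree. -/
inductive OrdTree.Reorder {α : Type} : OrdTree α → OrdTree α → Prop
  | perm {cs ds : List (List α × OrdTree α)} (h : cs.Perm ds) :
      OrdTree.Reorder (OrdTree.node cs) (OrdTree.node ds)
  | child {t t' : OrdTree α} (cs ds : List (List α × OrdTree α)) (d : List α)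
      (h : OrdTree.Reorder t t') :
      OrdTree.Reorder (OrdTree.node (cs ++ (d, t) :: ds)) (OrdTree.node (cs ++ (d, t') :: ds))

/-- Unordered data trees: trees up to the order of the edges below each node. The facts below
show that this is the least set closed under forming finite multisets of pairs `d : t`. -/
def Tree (α : Type) : Type := Quot (@OrdTree.Reorder α)

namespace Tree

variable {α : Type}

/-- The unordered tree of an ordered tree. -/
def mk (t : OrdTree α) : Tree α := Quot.mk _ t

/-- The multiset `{d₁ : t₁, …, dₙ : tₙ}` that a tree is. -/
def children : Tree α → Multiset (List α × Tree α) :=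
  Quot.lift
    (fun t => match t with
      | OrdTree.node cs => ((cs.map fun c => (c.1, mk c.2) : List _) : Multiset _))
    (by
      intro a b h
      cases h with
      | perm h => exact Multiset.coe_eq_coe.2 (h.map _)
      | child cs ds d h =>
        have e : mk _ = mk _ := Quot.sound h
        simp [e])

/-- The tree `{d₁ : t₁, …, dₙ : tₙ}` given by a multiset of pairs of a data value and a tree. -/
noncomputable def node (M : Multiset (List α × Tree α)) : Tree α :=
  mk (OrdTree.node (M.toList.map fun c => (c.1, Quot.out c.2)))

theorem mk_out (t : Tree α) : mk (Quot.out t) = t := Quot.out_eq t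

theorem children_node (M : Multiset (List α × Tree α)) : (node M).children = M := by
  show (((M.toList.map fun c => (c.1, Quot.out c.2)).map fun c => (c.1, mk c.2) : List _) :
    Multiset _) = M
  rw [List.map_map]
  have : ((fun c : List α × OrdTree α => (c.1, mk c.2)) ∘
      fun c : List α × Tree α => (c.1, Quot.out c.2)) = id := by
    funext c
    simp [mk_out]
  rw [this, List.map_id, Multiset.coe_toList]

theorem mk_node_replace (cs ds : List (List α × OrdTree α)) (d : List α) {t t' : OrdTree α}
    (h : mk t = mk t') :
    mk (OrdTree.node (cs ++ (d, t) :: ds)) = mk (OrdTree.node (cs ++ (d, t') :: ds)) := by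
  have h' := Quot.eqvGen_exact h
  clear h
  induction h' with
  | rel x y hxy => exact Quot.sound (OrdTree.Reorder.child cs ds d hxy)
  | refl x => rfl
  | symm x y _ ih => exact ih.symm
  | trans x y z _ _ ih1 ih2 => exact ih1.trans ih2

theorem mk_node_congr {ds es : List (List α × OrdTree α)}
    (h : List.Forall₂ (fun c e => c.1 = e.1 ∧ mk c.2 = mk e.2) ds es) :
    ∀ cs : List (List α × OrdTree α),
      mk (OrdTree.node (cs ++ ds)) = mk (OrdTree.node (cs ++ es)) := by
  induction h with
  | nil => intro cs; rfl
  | @cons c e ds es hce _ ih =>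
    intro cs
    obtain ⟨d, t⟩ := c
    obtain ⟨d', t'⟩ := e
    obtain ⟨h1, h2⟩ := hce
    simp only at h1 h2
    subst h1
    rw [mk_node_replace cs ds d h2]
    simpa using ih (cs ++ [(d, t')])

theorem mk_node (cs : List (List α × OrdTree α)) :
    mk (OrdTree.node cs) =
      node ((cs.map fun c => (c.1, mk c.2) : List (List α × Tree α)) : Multiset (List α × Tree α)) := by
  set M : Multiset (List α × Tree α) :=
    ((cs.map fun c => (c.1, mk c.2) : List (List α × Tree α)) : Multiset (List α × Tree α))
    with hM
  have hp : M.toList.Perm (cs.map fun c => (c.1, mk c.2)) := by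
    rw [← Multiset.coe_eq_coe, Multiset.coe_toList]
  have h1 : mk (OrdTree.node (M.toList.map fun c => (c.1, Quot.out c.2))) =
      mk (OrdTree.node ((cs.map fun c => (c.1, mk c.2)).map fun c => (c.1, Quot.out c.2))) :=
    Quot.sound (OrdTree.Reorder.perm (hp.map _))
  have h2 := mk_node_congr (ds := cs)
    (es := (cs.map fun c => (c.1, mk c.2)).map fun c => (c.1, Quot.out c.2)) (by
      rw [List.map_map, List.forall₂_map_right_iff]
      apply List.forall₂_same.2
      intro c _
      exact ⟨rfl, (mk_out _).symm⟩) []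
  exact h2.trans h1.symm

theorem node_children (t : Tree α) : node t.children = t := by
  induction t using Quot.ind with
  | mk t =>
    cases t with
    | node cs => exact (mk_node cs).symm

/-- Induction over trees: every tree is built from multisets of trees. -/
theorem induction {p : Tree α → Prop}
    (h : ∀ M : Multiset (List α × Tree α), (∀ c ∈ M, p c.2) → p (node M)) (t : Tree α) : p t := by
  have key : ∀ t : OrdTree α, p (mk t) := by
    intro t
    induction t using OrdTree.rec (motive_2 := fun l => ∀ c ∈ l, p (mk c.2))
      (motive_3 := fun c => p (mk c.2)) with
    | node cs ih =>
      rw [mk_node]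
      apply h
      intro c hc
      simp only [Multiset.mem_coe, List.mem_map] at hc
      obtain ⟨c', hc', rfl⟩ := hc
      exact ih c' hc'
    | nil => rename_i c hc; simp at hc
    | cons a l iha ihl =>
      rename_i c hc
      rcases List.mem_cons.1 hc with rfl | hc
      · exact iha
      · exact ihl c hc
    | mk d t ih => exact ih
  induction t using Quot.ind with
  | mk t => exact key t

end Tree

/-! ### Descriptor classes and automata for unordered trees

The countable set of properties is `ℕ`. Sizes are accounted for by the encodings below. -/

/-- A descriptor class: descriptors together with their satisfaction relation. -/
structure DescriptorClass (X : Type) where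
  /-- the descriptors -/
  Desc : Type
  /-- `Sat x h` means that the model `x` satisfies the descriptor `h` -/
  Sat : X → Desc → Prop

/-- The subclass given by a set of descriptors. -/
abbrev DescriptorClass.restrict {X : Type} (D : DescriptorClass X) (S : Set D.Desc) :
    DescriptorClass X where
  Desc := {h : D.Desc // h ∈ S}
  Sat x h := D.Sat x h.1

/-- Arities decorated with sets of properties, `{d₁ : Q₁, …, dₙ : Qₙ}`. -/
abbrev Arity (α : Type) : Type := Multiset (List α × Set ℕ)

/-- Horizontal descriptor classes over the data alphabet `α`. -/
abbrev HDescriptorClass (α : Type) : Type 1 := DescriptorClass (Arity α)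

/-- Satisfaction of `h` by `{d₁ : Q₁, …, dₙ : Qₙ}` depends only on the sets `Qᵢ ∩ S`. -/
def HDescriptorClass.DependsOnlyOn {α : Type} (D : HDescriptorClass α) (h : D.Desc)
    (S : Set ℕ) : Prop :=
  ∀ l : List (List α × Set ℕ × Set ℕ), (∀ x ∈ l, x.2.1 ∩ S = x.2.2 ∩ S) →
    (D.Sat (l.map fun x => (x.1, x.2.1) : List (List α × Set ℕ)) h ↔
      D.Sat (l.map fun x => (x.1, x.2.2) : List (List α × Set ℕ)) h)

/-- The support of a horizontal descriptor: the least set of properties it depends on. -/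
def HDescriptorClass.support {α : Type} (D : HDescriptorClass α) (h : D.Desc) : Set ℕ :=
  ⋂₀ {S | HDescriptorClass.DependsOnlyOn D h S}

/-- Alternating bottom-up automata for unordered trees, with horizontal descriptors in `D`.
Finite sets are presented as lists. -/
structure AUT {α : Type} (D : HDescriptorClass α) where
  /-- the vertical states -/
  states : List ℕ
  /-- the final states -/
  finals : List ℕ
  finals_subset : ∀ q ∈ finals, q ∈ states
  /-- the rules `h → q` -/
  rules : List (D.Desc × ℕ)
  rules_target : ∀ r ∈ rules, r.2 ∈ states
  rules_support : ∀ r ∈ rules, HDescriptorClass.support D r.1 ⊆ {q | q ∈ states}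

namespace AUT

variable {α : Type} {D : HDescriptorClass α}

/-- The states assigned to a node whose decorated arity is `M`. -/
def fire (A : AUT D) (M : Arity α) : Set ℕ := {q | ∃ h, (h, q) ∈ A.rules ∧ D.Sat M h}

/-- Evaluation, on ordered representatives. -/
def evalOrd (A : AUT D) : OrdTree α → Set ℕ
  | OrdTree.node cs =>
    A.fire ((cs.attach.map fun c => (c.1.1, evalOrd A c.1.2) : List _) : Multiset _)
termination_by t => sizeOf t
decreasing_by
  have h := List.sizeOf_lt_of_mem c.2
  have h' : sizeOf c.1 = 1 + sizeOf c.1.1 + sizeOf c.1.2 := by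
    rcases c with ⟨⟨a, b⟩, _⟩; rfl
  simp only [OrdTree.node.sizeOf_spec]
  omega

theorem evalOrd_node (A : AUT D) (cs : List (List α × OrdTree α)) :
    A.evalOrd (OrdTree.node cs) =
      A.fire ((cs.map fun c => (c.1, A.evalOrd c.2) : List _) : Multiset _) := by
  rw [evalOrd]
  congr 2
  have h := congrArg (List.map fun c : List α × OrdTree α => (c.1, A.evalOrd c.2))
    (List.attach_map_subtype_val cs)
  rw [List.map_map] at h
  exact h

theorem evalOrd_reorder (A : AUT D) {t t' : OrdTree α} (h : OrdTree.Reorder t t') :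
    A.evalOrd t = A.evalOrd t' := by
  induction h with
  | perm h =>
    rw [evalOrd_node, evalOrd_node]
    congr 1
    exact Multiset.coe_eq_coe.2 (h.map _)
  | child cs ds d h ih =>
    rw [evalOrd_node, evalOrd_node]
    simp [ih]

/-- The set of states to which the automaton evaluates a tree. -/
def eval (A : AUT D) : Tree α → Set ℕ :=
  Quot.lift A.evalOrd fun _ _ h => A.evalOrd_reorder h

/-- The defining equation of evaluation: `q` is assigned to `{d₁ : t₁, …, dₙ : tₙ}` iff there is
a rule `h → q` such that `{d₁ : eval t₁, …, dₙ : eval tₙ}` satisfies `h`. -/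
theorem eval_node (A : AUT D) (M : Multiset (List α × Tree α)) :
    A.eval (Tree.node M) =
      {q | ∃ h, (h, q) ∈ A.rules ∧ D.Sat (M.map fun c => (c.1, A.eval c.2)) h} := by
  show A.evalOrd (OrdTree.node _) = A.fire _
  rw [evalOrd_node, List.map_map]
  congr 1
  have : ((fun c : List α × OrdTree α => (c.1, A.evalOrd c.2)) ∘
      fun c : List α × Tree α => (c.1, Quot.out c.2)) = fun c => (c.1, A.eval c.2) := by
    funext c
    show (c.1, A.eval (Tree.mk (Quot.out c.2))) = _
    rw [Tree.mk_out]
  rw [this, ← Multiset.map_coe, Multiset.coe_toList]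

/-- The language of the automaton. -/
def language (A : AUT D) : Set (Tree α) := {t | (A.eval t ∩ {q | q ∈ A.finals}).Nonempty}

/-- Vertical determinism: every tree is evaluated to at most one state. -/
def VerticallyDeterministic (A : AUT D) : Prop := ∀ t : Tree α, (A.eval t).Subsingleton

end AUT

/-! ### Patterns and filters -/

/-- Regular expressions over `α`, with data values as atoms. -/
inductive Pattern (α : Type) : Type
  | word (d : List α) : Pattern α
  | cat (x y : Pattern α) : Pattern α
  | alt (x y : Pattern α) : Pattern α
  | star (x : Pattern α) : Pattern α

/-- The set of data values matched by a pattern. -/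
def Pattern.sem {α : Type} : Pattern α → Language α
  | Pattern.word d => ({d} : Set (List α))
  | Pattern.cat x y => x.sem * y.sem
  | Pattern.alt x y => x.sem + y.sem
  | Pattern.star x => KStar.kstar x.sem

/-- Filters: Boolean combinations of properties and of patterns from the class `P`. -/
inductive Filt {α : Type} (P : Set (Pattern α)) : Type
  | pat (x : P) : Filt P
  | state (q : ℕ) : Filt P
  | and (f g : Filt P) : Filt P
  | not (f : Filt P) : Filt P

/-- Satisfaction of a filter by a pair of a data value and a set of properties. -/
def Filt.Sat {α : Type} {P : Set (Pattern α)} (d : List α) (Q : Set ℕ) : Filt P → Prop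
  | Filt.pat x => d ∈ x.1.sem
  | Filt.state q => q ∈ Q
  | Filt.and f g => f.Sat d Q ∧ g.Sat d Q
  | Filt.not f => ¬ f.Sat d Q

/-- Singleton-validity: the filter holds for all `(d, Q)` with `Q` empty or a singleton. -/
def Filt.SingletonValid {α : Type} {P : Set (Pattern α)} (f : Filt P) : Prop :=
  ∀ (d : List α) (Q : Set ℕ), Q.Subsingleton → f.Sat d Q

/-! ### Horizontal automata and confluence -/

/-- Horizontal automata with filters over the pattern class `P`. Finite sets are presented as
lists; states are named by natural numbers. -/
structure HorAut {α : Type} (P : Set (Pattern α)) where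
  /-- the horizontal states -/
  states : List ℕ
  /-- the horizontal transitions -/
  rules : List ({p : ℕ // p ∈ states} × Filt P × {p : ℕ // p ∈ states})

namespace HorAut

variable {α : Type} {P : Set (Pattern α)}

/-- The horizontal states, as a type. -/
abbrev State (H : HorAut P) : Type := {p : ℕ // p ∈ H.states}

/-- In state `p` one can read `(d, Q)` and go to state `p'`. -/
def Reads (H : HorAut P) (p : H.State) (d : List α) (Q : Set ℕ) (p' : H.State) : Prop :=
  ∃ f : Filt P, (p, f, p') ∈ H.rules ∧ f.Sat d Q

/-- The horizontal rewriting relation: `(p, M + {d : Q}) → (p', M)`. -/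
inductive Step (H : HorAut P) : H.State × Arity α → H.State × Arity α → Prop
  | read {p p' : H.State} (M : Arity α) {d : List α} {Q : Set ℕ} (h : H.Reads p d Q p') :
      Step H (p, M + {(d, Q)}) (p', M)

/-- The failure-extended horizontal rewriting relation, where `none` stands for failure. -/
inductive FailStep (H : HorAut P) :
    Option (H.State × Arity α) → Option (H.State × Arity α) → Prop
  | step {c c' : H.State × Arity α} (h : H.Step c c') : FailStep H (some c) (some c')
  | fail {p : H.State} {M : Arity α} (hM : M ≠ 0) (h : ¬ ∃ c', H.Step (p, M) c') :
      FailStep H (some (p, M)) none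

/-- A horizontal automaton is confluent if its failure-extended rewriting relation is. -/
def Confluent (H : HorAut P) : Prop :=
  ∀ x y z : Option (H.State × Arity α),
    Relation.ReflTransGen H.FailStep x y → Relation.ReflTransGen H.FailStep x z →
      ∃ w, Relation.ReflTransGen H.FailStep y w ∧ Relation.ReflTransGen H.FailStep z w

/-- The descriptor class of a horizontal automaton: pairs `(p, p')` of states, satisfied by `M`
if `p'` can be reached from `p` while consuming `M`. -/
abbrev descriptorClass (H : HorAut P) : HDescriptorClass α where
  Desc := H.State × H.State
  Sat M h := Relation.ReflTransGen H.Step (h.1, M) (h.2, 0)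

/-- The subclass of the descriptors with initial state `p₀`. -/
abbrev descriptorClassFrom (H : HorAut P) (p₀ : H.State) : HDescriptorClass α :=
  H.descriptorClass.restrict {h | h.1 = p₀}

end HorAut

/-- A vertically deterministic automaton over the descriptors with a fixed initial state `p₀` of
a confluent horizontal automaton `H`, with filters over the pattern class `P`. -/
structure AUTC {α : Type} (P : Set (Pattern α)) where
  /-- the horizontal automaton -/
  H : HorAut P
  /-- the initial horizontal state -/
  p₀ : H.State
  /-- the vertical automaton -/
  aut : AUT (H.descriptorClassFrom p₀)
  confluent : H.Confluent
  deterministic : aut.VerticallyDeterministic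

namespace AUTC

variable {α : Type} {P : Set (Pattern α)}

/-- The language of the automaton. -/
def language (A : AUTC P) : Set (Tree α) := A.aut.language

/-- A vertical state is accessible if some tree is evaluated to it. -/
def VAccessible (A : AUTC P) (q : ℕ) : Prop := ∃ t : Tree α, q ∈ A.aut.eval t

/-- A horizontal state is accessible if it can be reached from the initial one by reading pairs
`(d, {q})` with `q` accessible. -/
def HAccessible (A : AUTC P) (p : A.H.State) : Prop :=
  ∃ M : Arity α, (∀ x ∈ M, ∃ q, A.VAccessible q ∧ x.2 = {q}) ∧
    Relation.ReflTransGen A.H.Step (A.p₀, M) (p, 0)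

/-- A horizontal state `p` is accepting if there is a vertical rule `(p₀, p) → q`. -/
def HAccepting (A : AUTC P) (p : A.H.State) : Prop := ∃ r ∈ A.aut.rules, r.1.1.2 = p

end AUTC

/-! ### Encodings as strings, and polynomial time -/

/-- The finite alphabet of the encodings. -/
inductive Sym (α : Type) : Type
  | bit (b : Bool) : Sym α
  | letter (a : α) : Sym α
  | word : Sym α
  | cat : Sym α
  | alt : Sym α
  | star : Sym α
  | state : Sym α
  | and : Sym α
  | not : Sym α
  | sep : Sym α
  | close : Sym α

/-- Names of states are written in binary. -/
def encodeName {α : Type} (n : ℕ) : List (Sym α) := (Computability.encodeNat n).map Sym.bit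

/-- Patterns in Polish notation. -/
def Pattern.encode {α : Type} : Pattern α → List (Sym α)
  | Pattern.word d => Sym.word :: d.map Sym.letter
  | Pattern.cat x y => Sym.cat :: (x.encode ++ y.encode)
  | Pattern.alt x y => Sym.alt :: (x.encode ++ y.encode)
  | Pattern.star x => Sym.star :: x.encode

/-- Filters in Polish notation. -/
def Filt.encode {α : Type} {P : Set (Pattern α)} : Filt P → List (Sym α)
  | Filt.pat x => x.1.encode
  | Filt.state q => Sym.state :: encodeName q
  | Filt.and f g => Sym.and :: (f.encode ++ g.encode)
  | Filt.not f => Sym.not :: f.encode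

/-- A name followed by a separator. -/
def encodeItem {α : Type} (n : ℕ) : List (Sym α) := encodeName n ++ [Sym.sep]

/-- An automaton is written as the lists of its vertical states, of its final states, of its
horizontal states and of its horizontal transitions, its initial horizontal state `p₀`, and the
list of its vertical rules `(p₀, p) → q`, written `p, q`. -/
def AUTC.encode {α : Type} {P : Set (Pattern α)} (A : AUTC P) : List (Sym α) :=
  A.aut.states.flatMap encodeItem ++ [Sym.close] ++
  A.aut.finals.flatMap encodeItem ++ [Sym.close] ++
  A.H.states.flatMap encodeItem ++ [Sym.close] ++
  A.H.rules.flatMap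
    (fun r => encodeItem r.1.1 ++ r.2.1.encode ++ [Sym.sep] ++ encodeItem r.2.2.1) ++
  [Sym.close] ++
  encodeItem A.p₀.1 ++
  A.aut.rules.flatMap (fun r => encodeItem r.1.1.2.1 ++ encodeItem r.2) ++ [Sym.close]

open Classical in
/-- The decision problem `p` on the instances `a : I`, written as strings by `enc`, is decided by
a Turing machine in time polynomial in the length of the input. -/
def DecidableInPTime {I Γ : Type} (enc : I → List Γ) (p : I → Prop) : Prop :=
  Nonempty (Turing.TM2ComputableInPolyTime enc Computability.encodeBool fun a => decide (p a))

end DataTree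

namespace DataTree

/-! ### The characterization of universality -/

namespace AUTC

variable {α : Type} {P : Set (Pattern α)}

/-! The characterization rests on two uses of determinism. By vertical determinism an accessible
state `q` is the whole evaluation of some tree, so every multiset of pairs `(d, {q})` with `q`
accessible is the decorated arity of a tree (`exists_children`). If all trees are accepted, each
such multiset is therefore consumed by a run ending in a state that has a rule. Confluence transfers
this to every other run: two complete runs end in the same state (`Confluent.eq_of_consume`), and a
run cannot get stuck on a multiset that another run consumes, since failure and `(p, 0)` are
distinct normal forms (`Confluent.exists_reads`). Conversely, if accessible states can read
everything and accept, reading greedily evaluates every tree, by induction on trees.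

For the algorithm, a set of horizontal and a set of vertical states are saturated, starting from the
initial state. A transition with filter `f` may be used if `f` holds at some `(d, {q})` with `q`
already found, that is, if `¬(f ∧ q)` is not singleton-valid. A state with outgoing filters `f₁, …,
fₙ` reads everything together with `q` iff `¬(¬f₁ ∧ … ∧ ¬fₙ ∧ q)` is singleton-valid. All questions
thus become validity queries of polynomial length. It need not be shown that saturation finds every
accessible state: by `language_eq_univ_iff_of_closed` the test is correct for any sets of accessible
states that contain the initial state and are closed under rules and transitions. Such sets are
reached after as many rounds as the input has symbols (`closed_iterate_round`).

For the time bound, the algorithm is written in a small language of stack programs with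
step-counting semantics and a subroutine call. The call is specified by an arbitrary relation `O`,
so programs are analysed without looking into the machine that answers queries. `steps_code` shows
that compilation preserves the number of steps; `nonempty_computableInPolyTime` packages this as a
Turing machine. What remains is one run lemma per subprogram, combined in `runs_universal`, and the
observation that the resulting bound is a polynomial. -/

theorem eval_eq_singleton (A : AUTC P) {t : Tree α} {q : ℕ} (h : q ∈ A.aut.eval t) :
    A.aut.eval t = {q} :=
  (A.deterministic t).eq_singleton_of_mem h

/-- An accessible state is the entire evaluation of a witnessing tree, so each pair can be replaced
by an edge to such a tree. -/
theorem exists_children (A : AUTC P) (M : Arity α)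
    (hM : ∀ x ∈ M, ∃ q, A.VAccessible q ∧ x.2 = {q}) :
    ∃ N : Multiset (List α × Tree α), N.map (fun c => (c.1, A.aut.eval c.2)) = M := by
  induction M using Multiset.induction_on with
  | empty => exact ⟨0, rfl⟩
  | cons x M ih =>
    obtain ⟨N, hN⟩ := ih fun y hy => hM y (Multiset.mem_cons_of_mem hy)
    obtain ⟨q, ⟨t, ht⟩, hx⟩ := hM x (Multiset.mem_cons_self x M)
    refine ⟨(x.1, t) ::ₘ N, ?_⟩
    rw [Multiset.map_cons, hN, A.eval_eq_singleton ht, ← hx]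

/-- The restriction of the descriptor class forces the first component of a descriptor to be `p₀`.
-/
theorem sat_iff (A : AUTC P) (M : Arity α) (h : (A.H.descriptorClassFrom A.p₀).Desc) :
    (A.H.descriptorClassFrom A.p₀).Sat M h ↔
      Relation.ReflTransGen A.H.Step (A.p₀, M) (h.1.2, 0) := by
  obtain ⟨⟨p, p'⟩, hp⟩ := h
  obtain rfl : p = A.p₀ := hp
  rfl

theorem mem_eval_node (A : AUTC P) (N : Multiset (List α × Tree α)) (q : ℕ) :
    q ∈ A.aut.eval (Tree.node N) ↔ ∃ r ∈ A.aut.rules, r.2 = q ∧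
      Relation.ReflTransGen A.H.Step (A.p₀, N.map fun c => (c.1, A.aut.eval c.2))
        (r.1.1.2, 0) := by
  rw [AUT.eval_node]
  constructor
  · rintro ⟨h, hr, hs⟩
    exact ⟨_, hr, rfl, (A.sat_iff _ h).1 hs⟩
  · rintro ⟨r, hr, rfl, hs⟩
    exact ⟨r.1, hr, (A.sat_iff _ r.1).2 hs⟩

end AUTC

/-! ### Normal forms and confluence of horizontal rewriting -/

namespace HorAut

variable {α : Type} {P : Set (Pattern α)}

theorem Step.add_right {H : HorAut P} {c c' : H.State × Arity α} (h : H.Step c c')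
    (N : Arity α) : H.Step (c.1, c.2 + N) (c'.1, c'.2 + N) := by
  cases h with
  | read M h =>
    have := Step.read (H := H) (M + N) h
    rwa [add_right_comm] at this

theorem reflTransGen_add_right {H : HorAut P} {c c' : H.State × Arity α}
    (h : Relation.ReflTransGen H.Step c c') (N : Arity α) :
    Relation.ReflTransGen H.Step (c.1, c.2 + N) (c'.1, c'.2 + N) := by
  induction h with
  | refl => exact .refl
  | tail _ h ih => exact ih.tail (h.add_right N)

theorem reflTransGen_failStep {H : HorAut P} {c c' : H.State × Arity α}
    (h : Relation.ReflTransGen H.Step c c') :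
    Relation.ReflTransGen H.FailStep (some c) (some c') := by
  induction h with
  | refl => exact .refl
  | tail _ h ih => exact ih.tail (.step h)

theorem not_step_zero {H : HorAut P} {p : H.State} {c : H.State × Arity α} :
    ¬ H.Step (p, 0) c := by
  generalize hx : (p, (0 : Arity α)) = x
  intro h
  cases h with
  | read M h =>
    have := congrArg Multiset.card (Prod.mk.inj hx).2
    simp at this

/-- Reading needs an element and failing needs a nonempty multiset, so `(p, 0)` is a normal form of
the extended relation. -/
theorem eq_of_failStep_zero {H : HorAut P} {p : H.State} {y : Option (H.State × Arity α)}
    (h : Relation.ReflTransGen H.FailStep (some (p, 0)) y) : y = some (p, 0) := by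
  rcases Relation.ReflTransGen.cases_head h with h | ⟨z, hz, -⟩
  · exact h.symm
  · cases hz with
    | step h => exact absurd h not_step_zero
    | fail hM _ => exact absurd rfl hM

theorem eq_none_of_failStep_none {H : HorAut P} {y : Option (H.State × Arity α)}
    (h : Relation.ReflTransGen H.FailStep none y) : y = none := by
  rcases Relation.ReflTransGen.cases_head h with h | ⟨z, hz, -⟩
  · exact h.symm
  · cases hz

/-- In a confluent horizontal automaton, the state in which a multiset is consumed is unique. -/
theorem Confluent.eq_of_consume {H : HorAut P} (hH : H.Confluent) {c : H.State × Arity α}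
    {p p' : H.State} (h : Relation.ReflTransGen H.Step c (p, 0))
    (h' : Relation.ReflTransGen H.Step c (p', 0)) : p = p' := by
  obtain ⟨w, h₁, h₂⟩ := hH _ _ _ (reflTransGen_failStep h) (reflTransGen_failStep h')
  have := (eq_of_failStep_zero h₁).symm.trans (eq_of_failStep_zero h₂)
  simpa using this

/-- In a confluent horizontal automaton, a multiset that can be consumed never gets stuck. -/
theorem Confluent.exists_reads {H : HorAut P} (hH : H.Confluent) {c : H.State × Arity α}
    {p p' : H.State} {d : List α} {Q : Set ℕ} (h : Relation.ReflTransGen H.Step c (p, {(d, Q)}))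
    (h' : Relation.ReflTransGen H.Step c (p', 0)) : ∃ p'', H.Reads p d Q p'' := by
  by_contra hn
  have hstuck : ¬ ∃ c', H.Step (p, ({(d, Q)} : Arity α)) c' := by
    rintro ⟨c', hc⟩
    generalize hx : (p, ({(d, Q)} : Arity α)) = x at hc
    cases hc with
    | @read p₁ p₂ M d' Q' hr =>
      simp only [Prod.mk.injEq] at hx
      obtain ⟨rfl, hx⟩ := hx
      have hm : (d', Q') ∈ ({(d, Q)} : Arity α) := by rw [hx]; simp
      rw [Multiset.mem_singleton, Prod.mk.injEq] at hm
      obtain ⟨rfl, rfl⟩ := hm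
      exact hn ⟨_, hr⟩
  -- Being stuck on a nonempty multiset leads to failure, which cannot be joined with the normal
  -- form `(p', 0)`.
  obtain ⟨w, h₁, h₂⟩ := hH _ _ _
    ((reflTransGen_failStep h).tail (.fail (Multiset.singleton_ne_zero _) hstuck))
    (reflTransGen_failStep h')
  have := (eq_none_of_failStep_none h₁).symm.trans (eq_of_failStep_zero h₂)
  simp at this

end HorAut

/-! ### Universality in terms of accessible states -/

namespace AUTC

variable {α : Type} {P : Set (Pattern α)}

theorem HAccessible.read {A : AUTC P} {p p' : A.H.State} (hp : A.HAccessible p) {d : List α}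
    {q : ℕ} (hq : A.VAccessible q) (h : A.H.Reads p d {q} p') : A.HAccessible p' := by
  obtain ⟨M, hM, hs⟩ := hp
  refine ⟨M + {(d, {q})}, ?_, ?_⟩
  · intro x hx
    rcases Multiset.mem_add.1 hx with hx | hx
    · exact hM x hx
    · rw [Multiset.mem_singleton] at hx
      exact ⟨q, hq, by rw [hx]⟩
  · have := HorAut.reflTransGen_add_right hs {(d, ({q} : Set ℕ))}
    exact this.tail (HorAut.Step.read 0 h)

theorem hAccessible_init (A : AUTC P) : A.HAccessible A.p₀ :=
  ⟨0, by simp, .refl⟩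

/-- The multiset witnessing horizontal accessibility is the arity of an actual tree, and the rule
fires at its root. -/
theorem HAccessible.vAccessible {A : AUTC P} {r} (hr : r ∈ A.aut.rules)
    (hp : A.HAccessible r.1.1.2) : A.VAccessible r.2 := by
  obtain ⟨M, hM, hs⟩ := hp
  obtain ⟨N, rfl⟩ := A.exists_children M hM
  exact ⟨Tree.node N, (A.mem_eval_node N r.2).2 ⟨r, hr, rfl, hs⟩⟩

theorem exists_consume (A : AUTC P) (hu : A.language = Set.univ) (M : Arity α)
    (hM : ∀ x ∈ M, ∃ q, A.VAccessible q ∧ x.2 = {q}) :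
    ∃ r ∈ A.aut.rules, Relation.ReflTransGen A.H.Step (A.p₀, M) (r.1.1.2, 0) := by
  obtain ⟨N, rfl⟩ := A.exists_children M hM
  have : Tree.node N ∈ A.language := hu ▸ Set.mem_univ _
  obtain ⟨q, hq, -⟩ := this
  obtain ⟨r, hr, -, hs⟩ := (A.mem_eval_node N q).1 hq
  exact ⟨r, hr, hs⟩

theorem language_eq_univ_iff (A : AUTC P) : A.language = Set.univ ↔
      (∀ q : ℕ, A.VAccessible q → q ∈ A.aut.finals) ∧
      (∀ p : A.H.State, A.HAccessible p → A.HAccepting p) ∧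
      (∀ p : A.H.State, A.HAccessible p → ∀ (d : List α) (q : ℕ), A.VAccessible q →
        ∃ p' : A.H.State, A.H.Reads p d {q} p') := by
  constructor
  · intro hu
    refine ⟨?_, ?_, ?_⟩
    · rintro q ⟨t, ht⟩
      have : t ∈ A.language := hu ▸ Set.mem_univ t
      obtain ⟨q', hq', hf⟩ := this
      rwa [A.deterministic t ht hq']
    · rintro p ⟨M, hM, hs⟩
      obtain ⟨r, hr, hs'⟩ := A.exists_consume hu M hM
      -- The run given by universality could a priori end in another state than `p`.
      exact ⟨r, hr, A.confluent.eq_of_consume hs' hs⟩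
    · rintro p ⟨M, hM, hs⟩ d q hq
      -- Some run consumes `M` together with the extra pair, so the run that has reached `p` with
      -- only this pair left is not stuck.
      obtain ⟨r, hr, hs'⟩ := A.exists_consume hu (M + {(d, {q})}) (by
        intro x hx
        rcases Multiset.mem_add.1 hx with hx | hx
        · exact hM x hx
        · rw [Multiset.mem_singleton] at hx
          exact ⟨q, hq, by rw [hx]⟩)
      have h := HorAut.reflTransGen_add_right hs {(d, ({q} : Set ℕ))}
      simp only [zero_add] at h
      exact A.confluent.exists_reads h hs'
  · rintro ⟨h₁, h₂, h₃⟩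
    have key : ∀ M : Arity α, (∀ x ∈ M, ∃ q, A.VAccessible q ∧ x.2 = {q}) →
        ∃ p, Relation.ReflTransGen A.H.Step (A.p₀, M) (p, 0) := by
      intro M
      -- The induction reads one pair at a time and so has to start from arbitrary accessible
      -- states.
      suffices H : ∀ p, A.HAccessible p → (∀ x ∈ M, ∃ q, A.VAccessible q ∧ x.2 = {q}) →
          ∃ p', Relation.ReflTransGen A.H.Step (p, M) (p', 0) from H _ A.hAccessible_init
      induction M using Multiset.induction_on with
      | empty => exact fun p _ _ => ⟨p, .refl⟩
      | cons x M ih =>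
        intro p hp hM
        obtain ⟨q, hq, hx⟩ := hM x (Multiset.mem_cons_self x M)
        obtain ⟨d, Q⟩ := x
        obtain rfl : Q = {q} := hx
        obtain ⟨p', hr⟩ := h₃ p hp d q hq
        obtain ⟨p'', hs⟩ := ih p' (hp.read hq hr) fun y hy => hM y (Multiset.mem_cons_of_mem hy)
        refine ⟨p'', .head ?_ hs⟩
        rw [← Multiset.singleton_add, add_comm]
        exact HorAut.Step.read M hr
    rw [Set.eq_univ_iff_forall]
    intro t
    have hne : (A.aut.eval t).Nonempty := by
      induction t using Tree.induction with
      | h N ih =>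
        have hN : ∀ x ∈ N.map (fun c => (c.1, A.aut.eval c.2)),
            ∃ q, A.VAccessible q ∧ x.2 = {q} := by
          intro x hx
          obtain ⟨c, hc, rfl⟩ := Multiset.mem_map.1 hx
          obtain ⟨q, hq⟩ := ih c hc
          exact ⟨q, ⟨_, hq⟩, A.eval_eq_singleton hq⟩
        obtain ⟨p, hp⟩ := key _ hN
        obtain ⟨r, hr, rfl⟩ := h₂ p ⟨_, hN, hp⟩
        exact ⟨r.2, (A.mem_eval_node N _).2 ⟨r, hr, rfl, hp⟩⟩
    obtain ⟨q, hq⟩ := hne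
    exact ⟨q, hq, h₁ q ⟨t, hq⟩⟩

end AUTC

end DataTree

/-! ### A structured language for stack machines with a subroutine -/

namespace StackProg

open Turing Function

/-- Structured programs over stacks indexed by `V` with symbols in `G`. -/
inductive Cmd (V G : Type) : Type
  | skip : Cmd V G
  | push (v : V) (a : G) : Cmd V G
  | pop (v : V) : Cmd V G
  | seq (c d : Cmd V G) : Cmd V G
  /-- branch on the top symbol of a stack -/
  | case (v : V) (f : Option G → Cmd V G) : Cmd V G
  /-- repeat as long as the top symbol of a stack has a given property -/
  | loop (v : V) (p : Option G → Bool) (c : Cmd V G) : Cmd V G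
  /-- pass the reversed contents of a stack to the subroutine and replace them by its answer -/
  | call (v : V) : Cmd V G

section Semantics

variable {V G : Type} [DecidableEq V] (ans : Bool → G) (O : List G → Bool → ℕ → Prop)

/-- Big-step semantics with step counts. `O w b n` says that the subroutine answers `b` on the
stack contents `w` in `n` steps, and `ans` codes answers as symbols. -/
inductive Exec : Cmd V G → (V → List G) → ℕ → (V → List G) → Prop
  | skip (S) : Exec .skip S 1 S
  | push (v a S) : Exec (.push v a) S 1 (update S v (a :: S v))
  | pop (v S) : Exec (.pop v) S 1 (update S v (S v).tail)
  | seq {c d S S' S'' m n} : Exec c S m S' → Exec d S' n S'' → Exec (.seq c d) S (m + n) S''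
  | case {v f S S' n} : Exec (f (S v).head?) S n S' → Exec (.case v f) S (1 + n) S'
  | loop_done {v p c S} : p (S v).head? = false → Exec (.loop v p c) S 1 S
  | loop_step {v p c S S' S'' m n} : p (S v).head? = true → Exec c S m S' →
      Exec (.loop v p c) S' n S'' → Exec (.loop v p c) S (1 + (m + n)) S''
  | call {v S b n} : O (S v) b n → Exec (.call v) S n (update S v [ans b])

end Semantics

/-! ### Reachability in a given number of steps -/

section Steps

variable {K : Type} [DecidableEq K] {Γ : K → Type} {Λ σ : Type}

/-- `Steps M n c c'`: the machine `M` goes from `c` to `c'` in exactly `n` steps. -/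
def Steps (M : Λ → TM2.Stmt Γ Λ σ) (n : ℕ) (c c' : TM2.Cfg Γ Λ σ) : Prop :=
  (flip bind (TM2.step M))^[n] (some c) = some c'

theorem Steps.trans {M : Λ → TM2.Stmt Γ Λ σ} {m n : ℕ} {a b c : TM2.Cfg Γ Λ σ}
    (h : Steps M m a b) (h' : Steps M n b c) : Steps M (m + n) a c := by
  rw [Steps] at *
  rw [add_comm, Function.iterate_add_apply, h, h']

theorem Steps.one (M : Λ → TM2.Stmt Γ Λ σ) (l : Λ) (v : σ) (S : ∀ k, List (Γ k)) :
    Steps M 1 ⟨some l, v, S⟩ (TM2.stepAux (M l) v S) := rfl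

theorem Steps.head {M : Λ → TM2.Stmt Γ Λ σ} {n : ℕ} {l : Λ} {v : σ} {S : ∀ k, List (Γ k)}
    {c : TM2.Cfg Γ Λ σ} (h : Steps M n (TM2.stepAux (M l) v S) c) :
    Steps M (1 + n) ⟨some l, v, S⟩ c :=
  (Steps.one M l v S).trans h

theorem iterate_none (M : Λ → TM2.Stmt Γ Λ σ) (n : ℕ) :
    (flip bind (TM2.step M))^[n] none = none := by
  induction n with
  | zero => rfl
  | succ n ih => rw [Function.iterate_succ_apply]; exact ih

end Steps

/-! ### Compilation -/

section Compile

variable {V G : Type} (tm : FinTM2)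

/-- The stack alphabets of the compiled machine. -/
abbrev alph (V G : Type) (tm : FinTM2) : V ⊕ tm.K → Type
  | .inl _ => G
  | .inr k => tm.Γ k

/-- The internal states of the compiled machine. -/
abbrev Reg (G : Type) (tm : FinTM2) : Type := Option G × tm.σ

/-- The statements of the compiled machine. -/
abbrev CStmt (V G : Type) (tm : FinTM2) (Λ : Type) : Type := TM2.Stmt (alph V G tm) Λ (Reg G tm)

/-- The stacks of the compiled machine: those of the program and those of the subroutine. -/
def joint (S : V → List G) (T : ∀ k, List (tm.Γ k)) : ∀ k, List (alph V G tm k)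
  | .inl v => S v
  | .inr k => T k

section StepAux

variable [DecidableEq V] (S : V → List G) (T : ∀ k, List (tm.Γ k)) {Λ : Type}
  (q : CStmt V G tm Λ) (s : Reg G tm)

theorem update_joint_inl (v : V) (l : List G) :
    update (joint tm S T) (.inl v) l = joint tm (update S v l) T := by
  funext k
  rcases k with w | k
  · by_cases h : w = v
    · subst h
      exact (update_self (f := joint tm S T) (Sum.inl w) l).trans (update_self w l S).symm
    · exact (update_of_ne (f := joint tm S T) (a := Sum.inl w) (by simpa using h) _).trans
        (update_of_ne h l S : update S v l w = S w).symm
  · exact update_of_ne (f := joint tm S T) (a := Sum.inr k) (by simp) _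

theorem update_joint_inr (k : tm.K) (l : List (tm.Γ k)) :
    update (joint tm S T) (.inr k) l = joint tm S (update T k l) := by
  funext j
  rcases j with w | j
  · exact update_of_ne (f := joint tm S T) (a := Sum.inl w) (by simp) _
  · by_cases h : j = k
    · subst h
      exact (update_self (f := joint tm S T) (Sum.inr j) l).trans (update_self j l T).symm
    · exact (update_of_ne (f := joint tm S T) (a := Sum.inr j) (by simpa using h) _).trans
        (update_of_ne h l T : update T k l j = T j).symm

theorem stepAux_push_inl (v : V) (f : Reg G tm → G) :
    TM2.stepAux (.push (.inl v) f q) s (joint tm S T) =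
      TM2.stepAux q s (joint tm (update S v (f s :: S v)) T) :=
  congrArg (TM2.stepAux q s) (update_joint_inl tm S T v (f s :: S v))

theorem stepAux_peek_inl (v : V) (f : Reg G tm → Option G → Reg G tm) :
    TM2.stepAux (.peek (.inl v) f q) s (joint tm S T) =
      TM2.stepAux q (f s (S v).head?) (joint tm S T) :=
  rfl

theorem stepAux_pop_inl (v : V) (f : Reg G tm → Option G → Reg G tm) :
    TM2.stepAux (.pop (.inl v) f q) s (joint tm S T) =
      TM2.stepAux q (f s (S v).head?) (joint tm (update S v (S v).tail) T) :=
  congrArg (TM2.stepAux q (f s (S v).head?)) (update_joint_inl tm S T v (S v).tail)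

theorem stepAux_push_inr (k : tm.K) (f : Reg G tm → tm.Γ k) :
    TM2.stepAux (.push (.inr k) f q) s (joint tm S T) =
      TM2.stepAux q s (joint tm S (update T k (f s :: T k))) :=
  congrArg (TM2.stepAux q s) (update_joint_inr tm S T k (f s :: T k))

theorem stepAux_peek_inr (k : tm.K) (f : Reg G tm → Option (tm.Γ k) → Reg G tm) :
    TM2.stepAux (.peek (.inr k) f q) s (joint tm S T) =
      TM2.stepAux q (f s (T k).head?) (joint tm S T) :=
  rfl

theorem stepAux_pop_inr (k : tm.K) (f : Reg G tm → Option (tm.Γ k) → Reg G tm) :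
    TM2.stepAux (.pop (.inr k) f q) s (joint tm S T) =
      TM2.stepAux q (f s (T k).head?) (joint tm S (update T k (T k).tail)) :=
  congrArg (TM2.stepAux q (f s (T k).head?)) (update_joint_inr tm S T k (T k).tail)

end StepAux

/-- A statement of the subroutine as a statement of the compiled machine, which goes to the label
`r` instead of halting. -/
def embed {Λ : Type} (ι : tm.Λ → Λ) (r : Λ) :
    TM2.Stmt tm.Γ tm.Λ tm.σ → CStmt V G tm Λ
  | .push k f q => .push (.inr k) (fun s => f s.2) (embed ι r q)
  | .peek k f q => .peek (.inr k) (fun s x => (s.1, f s.2 x)) (embed ι r q)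
  | .pop k f q => .pop (.inr k) (fun s x => (s.1, f s.2 x)) (embed ι r q)
  | .load f q => .load (fun s => (s.1, f s.2)) (embed ι r q)
  | .branch f q q' => .branch (fun s => f s.2) (embed ι r q) (embed ι r q')
  | .goto f => .goto fun s => ι (f s.2)
  | .halt => .goto fun _ => r

/-- A configuration of the subroutine inside the compiled machine. -/
def embedCfg {Λ : Type} (ι : tm.Λ → Λ) (r : Λ) (x : Option G) (S : V → List G)
    (c : TM2.Cfg tm.Γ tm.Λ tm.σ) : TM2.Cfg (alph V G tm) Λ (Reg G tm) :=
  ⟨some (c.l.elim r ι), (x, c.var), joint tm S c.stk⟩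

/-- The only change of control is that halting becomes a jump to `r`; `embedCfg` accordingly places
a halted configuration at `r`. -/
theorem stepAux_embed [DecidableEq V] {Λ : Type} (ι : tm.Λ → Λ) (r : Λ) (x : Option G)
    (S : V → List G) (q : TM2.Stmt tm.Γ tm.Λ tm.σ) : ∀ (s : tm.σ) (T : ∀ k, List (tm.Γ k)),
    TM2.stepAux (embed (V := V) (G := G) tm ι r q) (x, s) (joint tm S T) =
      embedCfg tm ι r x S (TM2.stepAux q s T) := by
  induction q with
  | push k f q ih => exact fun s T => (stepAux_push_inr tm S T _ _ k _).trans (ih _ _)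
  | peek k f q ih => exact fun s T => (stepAux_peek_inr tm S T _ _ k _).trans (ih _ _)
  | pop k f q ih => exact fun s T => (stepAux_pop_inr tm S T _ _ k _).trans (ih _ _)
  | load f q ih => exact fun s T => ih _ _
  | branch f q q' ih ih' =>
    intro s T
    simp only [embed, TM2.stepAux]
    cases f s <;> simp only [cond_true, cond_false, ih, ih']
  | goto f => intro s T; rfl
  | halt => intro s T; rfl

/-- A halted configuration has no successor, so a run of `n` steps can halt only at its end. The
halting step is itself the jump to `r`, whence no step is lost or added. -/
theorem steps_embed [DecidableEq V] {Λ : Type} {M : Λ → CStmt V G tm Λ} (ι : tm.Λ → Λ) (r : Λ)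
    (hM : ∀ l, M (ι l) = embed tm ι r (tm.m l)) (x : Option G) (S : V → List G) (n : ℕ) :
    ∀ c c' : TM2.Cfg tm.Γ tm.Λ tm.σ, Steps tm.m n c c' →
      Steps M n (embedCfg tm ι r x S c) (embedCfg tm ι r x S c') := by
  induction n with
  | zero =>
    intro c c' h
    cases h
    rfl
  | succ n ih =>
    intro c c' h
    rw [Steps, Function.iterate_succ_apply] at h
    obtain ⟨l, s, T⟩ := c
    cases l with
    | none => exact absurd (h.symm.trans (iterate_none tm.m n)) (by simp)
    | some l =>
      have := ih _ _ h
      rw [add_comm]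
      apply Steps.head
      simp only [Option.elim_some]
      rw [hM, stepAux_embed]
      exact this

/-- The labels of a compiled program. -/
inductive Label : Cmd V G → Type
  | skip : Label .skip
  | push (v a) : Label (.push v a)
  | pop (v) : Label (.pop v)
  | fst {c d} (l : Label c) : Label (.seq c d)
  | snd {c d} (l : Label d) : Label (.seq c d)
  | case (v f) : Label (.case v f)
  | alternative {v f} (o) (l : Label (f o)) : Label (.case v f)
  | loop (v p c) : Label (.loop v p c)
  | body {v p c} (l : Label c) : Label (.loop v p c)
  | load (v) : Label (.call v)
  | run {v} (l : tm.Λ) : Label (.call v)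
  | ret (v) : Label (.call v)

/-- Finiteness of `G` is needed for `case`, which has a separate copy of labels for each possible
top symbol. -/
theorem finite_label [Finite G] (c : Cmd V G) : Finite (Label tm c) := by
  induction c with
  | skip => exact Finite.of_surjective (fun _ : Unit => .skip) (by rintro ⟨⟩; exact ⟨(), rfl⟩)
  | push v a => exact Finite.of_surjective (fun _ : Unit => .push v a) (by rintro ⟨⟩; exact ⟨(), rfl⟩)
  | pop v => exact Finite.of_surjective (fun _ : Unit => .pop v) (by rintro ⟨⟩; exact ⟨(), rfl⟩)
  | seq c d ihc ihd =>
    refine Finite.of_surjective (Sum.elim (.fst (tm := tm)) .snd) ?_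
    rintro (_ | _)
    exacts [⟨.inl _, rfl⟩, ⟨.inr _, rfl⟩]
  | case v f ih =>
    refine Finite.of_surjective
      (fun x : Option (Σ o, Label tm (f o)) => x.elim (.case v f) fun y => .alternative y.1 y.2) ?_
    rintro (_ | _)
    exacts [⟨none, rfl⟩, ⟨some ⟨_, _⟩, rfl⟩]
  | loop v p c ih =>
    refine Finite.of_surjective
      (fun x : Option (Label tm c) => x.elim (.loop v p c) (.body (v := v) (p := p))) ?_
    rintro (_ | _)
    exacts [⟨none, rfl⟩, ⟨some _, rfl⟩]
  | call v =>
    have := tm.ΛFin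
    refine Finite.of_surjective
      (fun x : Bool ⊕ tm.Λ => x.elim (fun b => cond b (.load v) (.ret v)) .run) ?_
    rintro (_ | _)
    exacts [⟨.inl true, rfl⟩, ⟨.inr _, rfl⟩, ⟨.inl false, rfl⟩]

/-- The first label of a compiled program. -/
def entry : ∀ c : Cmd V G, Label tm c
  | .skip => .skip
  | .push v a => .push v a
  | .pop v => .pop v
  | .seq c _ => .fst (entry c)
  | .case v f => .case v f
  | .loop v p c => .loop v p c
  | .call v => .load v

variable (inp : G → tm.Γ tm.k₀) (out : Option (tm.Γ tm.k₁) → G)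

/-- The code of a compiled program, which continues with the statement `k`. -/
def code {Λ : Type} : ∀ {c : Cmd V G}, (Label tm c → Λ) → CStmt V G tm Λ →
    Label tm c → CStmt V G tm Λ
  | .skip, _, k, .skip => k
  | .push v a, _, k, .push _ _ => .push (.inl v) (fun _ => a) k
  | .pop v, _, k, .pop _ => .pop (.inl v) (fun s _ => s) k
  | .seq _ d, ι, _, .fst l =>
    code (fun l => ι (.fst l)) (.goto fun _ => ι (.snd (entry tm d))) l
  | .seq _ _, ι, k, .snd l => code (fun l => ι (.snd l)) k l
  | .case v f, ι, _, .case _ _ =>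
    .peek (.inl v) (fun s o => (o, s.2)) (.goto fun s => ι (.alternative s.1 (entry tm (f s.1))))
  | .case _ _, ι, k, .alternative o l => code (fun l => ι (.alternative o l)) k l
  | .loop v p c, ι, k, .loop _ _ _ =>
    .peek (.inl v) (fun s o => (o, s.2))
      (.branch (fun s => p s.1) (.goto fun _ => ι (.body (entry tm c))) k)
  | .loop v p c, ι, _, .body l =>
    code (fun l => ι (.body l)) (.goto fun _ => ι (.loop v p c)) l
  | .call v, ι, _, .load _ =>
    .pop (.inl v) (fun s o => (o, s.2))
      (.branch (fun s => s.1.isSome)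
        -- The default `out none` only makes the term total: this branch is taken when the register
        -- holds a symbol.
        (.push (.inr tm.k₀) (fun s => inp (s.1.getD (out none))) (.goto fun _ => ι (.load v)))
        (.goto fun _ => ι (.run tm.main)))
  | .call v, ι, _, .run l => embed tm (fun l => ι (.run l)) (ι (.ret v)) (tm.m l)
  | .call v, _, k, .ret _ =>
    .pop (.inr tm.k₁) (fun s o => (some (out o), s.2))
      (.push (.inl v) (fun s => s.1.getD (out none)) k)

/-- The subroutine, as a relation between the contents of a stack, the answer, and the number of
steps of a call. -/
def Answers (ans : Bool → tm.Γ tm.k₁) (w : List G) (b : Bool) (n : ℕ) : Prop :=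
  ∃ m, Steps tm.m m (initList tm (w.reverse.map inp)) (haltList tm [ans b]) ∧
    n = w.length + 1 + (m + 1)

theorem initList_eq (l : List (tm.Γ tm.k₀)) :
    initList tm l = ⟨some tm.main, tm.initialState, update (fun _ => []) tm.k₀ l⟩ := by
  rw [initList]
  congr 1
  funext k
  by_cases h : k = tm.k₀
  · subst h; simp
  · simp [h]

theorem haltList_eq (l : List (tm.Γ tm.k₁)) :
    haltList tm l = ⟨none, tm.initialState, update (fun _ => []) tm.k₁ l⟩ := by
  rw [haltList]
  congr 1
  funext k
  by_cases h : k = tm.k₁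
  · subst h; simp
  · simp [h]

theorem update_nil (k : tm.K) :
    update (fun _ => []) k [] = fun k => ([] : List (tm.Γ k)) :=
  update_eq_self_iff.2 rfl

/-- The configuration of the compiled machine between two commands. -/
def idle {Λ : Type} (l : Λ) (x : Option G) (S : V → List G) :
    TM2.Cfg (alph V G tm) Λ (Reg G tm) :=
  ⟨some l, (x, tm.initialState), joint tm S fun _ => []⟩

variable [DecidableEq V]

/-- The label `load` jumps to itself, moving one symbol per step to the input stack of the
subroutine, which reverses the word. The additional step is the pop that finds the stack empty. -/
theorem steps_load {Λ : Type} {M : Λ → CStmt V G tm Λ} {v : V} (ι : Label tm (.call v) → Λ)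
    (k : CStmt V G tm Λ) (hM : ∀ l, M (ι l) = code tm inp out ι k l)
    (w : List G) : ∀ (u : List (tm.Γ tm.k₀)) (x : Option G) (S : V → List G), S v = w →
      ∃ x', Steps M (w.length + 1)
        ⟨some (ι (.load v)), (x, tm.initialState),
          joint tm S (update (fun _ => []) tm.k₀ u)⟩
        ⟨some (ι (.run tm.main)), (x', tm.initialState), joint tm (update S v [])
          (update (fun _ => []) tm.k₀ (w.reverse.map inp ++ u))⟩ := by
  induction w with
  | nil =>
    intro u x S hS
    refine ⟨none, ?_⟩
    rw [List.length_nil, zero_add]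
    have := Steps.one M (ι (.load v)) (x, tm.initialState)
      (joint tm S (update (fun _ => []) tm.k₀ u))
    rw [hM, code, stepAux_pop_inl, hS] at this
    exact this
  | cons a w ih =>
    intro u x S hS
    obtain ⟨x', hx⟩ := ih (inp a :: u) (some a) (update S v w) (by simp)
    refine ⟨x', ?_⟩
    rw [List.length_cons, add_comm (w.length + 1)]
    apply Steps.head
    rw [hM, code, stepAux_pop_inl, hS]
    -- `TM2.stepAux.eq_5` is the defining equation for `branch`.
    simp only [List.head?_cons, TM2.stepAux.eq_5, Option.isSome_some, cond_true]
    rw [stepAux_push_inr]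
    simpa using hx

variable (ans : Bool → tm.Γ tm.k₁)

/-- Compiled programs do what they should, in the right number of steps. -/
theorem steps_code {c : Cmd V G} {S S' : V → List G} {n : ℕ}
    (h : Exec (fun b => out (some (ans b))) (Answers tm inp ans) c S n S') :
    ∀ {Λ : Type} {M : Λ → CStmt V G tm Λ} (ι : Label tm c → Λ) (k : CStmt V G tm Λ),
      (∀ l, M (ι l) = code tm inp out ι k l) → ∀ x : Option G, ∃ x' : Option G,
        Steps M n (idle tm (ι (entry tm c)) x S)
          (TM2.stepAux k (x', tm.initialState) (joint tm S' fun _ => [])) := by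
  induction h with
  | skip S =>
    intro Λ M ι k hM x
    refine ⟨x, ?_⟩
    have := Steps.one M (ι .skip) (x, tm.initialState) (joint tm S fun _ => [])
    rwa [hM, code] at this
  | push v a S =>
    intro Λ M ι k hM x
    refine ⟨x, ?_⟩
    have := Steps.one M (ι (.push v a)) (x, tm.initialState) (joint tm S fun _ => [])
    rwa [hM, code, stepAux_push_inl] at this
  | pop v S =>
    intro Λ M ι k hM x
    refine ⟨x, ?_⟩
    have := Steps.one M (ι (.pop v)) (x, tm.initialState) (joint tm S fun _ => [])
    rwa [hM, code, stepAux_pop_inl] at this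
  | @seq c d S S' S'' m n _ _ ihc ihd =>
    intro Λ M ι k hM x
    obtain ⟨x', hx'⟩ := ihc (fun l => ι (.fst l)) _ (fun l => hM (.fst l)) x
    obtain ⟨x'', hx''⟩ := ihd (fun l => ι (.snd l)) _ (fun l => hM (.snd l)) x'
    exact ⟨x'', hx'.trans hx''⟩
  | @case v f S S' n _ ih =>
    intro Λ M ι k hM x
    obtain ⟨x', hx'⟩ := ih (fun l => ι (.alternative _ l)) _ (fun l => hM (.alternative _ l))
      (S v).head?
    refine ⟨x', Steps.head ?_⟩
    rw [entry, hM, code, stepAux_peek_inl]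
    exact hx'
  | @loop_done v p c S hp =>
    intro Λ M ι k hM x
    refine ⟨(S v).head?, ?_⟩
    have := Steps.one M (ι (.loop v p c)) (x, tm.initialState) (joint tm S fun _ => [])
    rw [hM, code, stepAux_peek_inl, TM2.stepAux.eq_5, hp] at this
    exact this
  | @loop_step v p c S S' S'' m n hp _ _ ihc ihw =>
    intro Λ M ι k hM x
    obtain ⟨x', hx'⟩ := ihc (fun l => ι (.body l)) _ (fun l => hM (.body l)) (S v).head?
    obtain ⟨x'', hx''⟩ := ihw ι k hM x'
    refine ⟨x'', Steps.head ?_⟩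
    rw [entry, hM, code, stepAux_peek_inl, TM2.stepAux.eq_5, hp]
    exact hx'.trans hx''
  | @call v S b n hO =>
    intro Λ M ι k hM x
    obtain ⟨m, hm, rfl⟩ := hO
    obtain ⟨x', hx'⟩ := steps_load tm inp out ι k hM (S v) [] x S rfl
    refine ⟨some (out (some (ans b))), ?_⟩
    rw [update_nil, List.append_nil] at hx'
    refine hx'.trans ?_
    have hrun := steps_embed tm (M := M) (fun l => ι (.run l)) (ι (.ret v))
      (fun l => by rw [hM, code]) x' (update S v []) m _ _ hm
    rw [initList_eq, haltList_eq] at hrun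
    -- `haltList` prescribes the initial internal state and empty stacks apart from the output.
    -- Popping the answer hence leaves the subroutine ready for the next call.
    refine hrun.trans ?_
    have := Steps.one M (ι (.ret v)) (x', tm.initialState)
      (joint tm (update S v []) (update (fun _ => []) tm.k₁ [ans b]))
    rw [hM, code, stepAux_pop_inr, stepAux_push_inl] at this
    simpa [update_nil, embedCfg] using this

end Compile

/-! ### Time-bounded runs and the passage to Turing machines -/

section Run

variable {V G : Type} [DecidableEq V] (ans : Bool → G) (O : List G → Bool → ℕ → Prop)

/-- `Runs ans O c S n S'`: the program `c` goes from `S` to `S'` in at most `n` steps. -/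
def Runs (c : Cmd V G) (S : V → List G) (n : ℕ) (S' : V → List G) : Prop :=
  ∃ m ≤ n, Exec ans O c S m S'

end Run

/-- A structured program that uses a polynomial-time subroutine and runs in polynomial time
gives a polynomial-time Turing machine. The program answers "no" by leaving a symbol on the
stack `v₁`. -/
theorem nonempty_computableInPolyTime {V G I J : Type} [DecidableEq V] [Finite V] [Finite G]
    {encJ : J → List G} {g : J → Bool}
    (h : TM2ComputableInPolyTime encJ Computability.encodeBool g)
    (ans : Bool → G) (c : Cmd V G) (v₀ v₁ : V) (x₁ : G) {enc : I → List G} {f : I → Bool}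
    (T : Polynomial ℕ)
    (hc : ∀ O : List G → Bool → ℕ → Prop,
      (∀ j, ∃ n ≤ (encJ j).length + h.time.eval (encJ j).length + 2,
        O (encJ j).reverse (g j) n) →
      ∀ i, Runs ans O c (update (fun _ => []) v₀ (enc i)) (T.eval (enc i).length)
        (update (fun _ => []) v₁ (if f i then [] else [x₁]))) :
    Nonempty (TM2ComputableInPolyTime enc Computability.encodeBool f) := by
  classical
  have := Fintype.ofFinite V
  have := Fintype.ofFinite G
  have := finite_label h.tm c
  have := Fintype.ofFinite (Label h.tm c)
  have := h.tm.kFin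
  have := h.tm.σFin
  set inp : G → h.tm.Γ h.tm.k₀ := h.inputAlphabet.invFun with hinp
  -- The value `false` at `none` is arbitrary: a completed call always leaves an answer.
  set out : Option (h.tm.Γ h.tm.k₁) → G :=
    fun o => ans ((o.map h.outputAlphabet).getD false) with hout
  set res : Bool → h.tm.Γ h.tm.k₁ := h.outputAlphabet.invFun with hres
  have hans : (fun b => out (some (res b))) = ans := by
    funext b
    simp [hout, hres]
  -- Loading takes one step more than the length of the word and returning takes one step, which
  -- explains the summands besides `h.time`.
  have key := hc (Answers h.tm inp res) (by
    intro j
    have hj := h.outputsFun j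
    refine ⟨_, ?_, hj.steps, ?_, rfl⟩
    · have := hj.steps_le_m
      rw [List.length_reverse]
      omega
    · rw [List.reverse_reverse]
      exact hj.evals_in_steps)
  -- An empty `v₁` means "yes". The register is reset since `haltList` demands the initial internal
  -- state.
  let k : CStmt V G h.tm (Label h.tm c) :=
    .pop (.inl v₁) (fun s o => (o, s.2))
      (.push (.inr h.tm.k₁) (fun s => res s.1.isNone)
        (.load (fun _ => (none, h.tm.initialState)) .halt))
  let M : FinTM2 :=
    { K := V ⊕ h.tm.K
      k₀ := .inl v₀
      k₁ := .inr h.tm.k₁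
      Γ := alph V G h.tm
      Λ := Label h.tm c
      main := entry h.tm c
      σ := Reg G h.tm
      initialState := (none, h.tm.initialState)
      Γk₀Fin := inferInstanceAs (Fintype G)
      m := code h.tm inp out id k }
  have hinit : ∀ w : List G, initList M w =
      idle h.tm (entry h.tm c) none (update (fun _ => []) v₀ w) := by
    intro w
    rw [initList_eq]
    exact congrArg (fun S => (⟨some (entry h.tm c), (none, h.tm.initialState), S⟩ :
      TM2.Cfg (alph V G h.tm) (Label h.tm c) (Reg G h.tm)))
      ((congrArg (fun S => update S (Sum.inl v₀) w) (show (fun _ => []) =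
        joint h.tm (fun _ : V => ([] : List G)) (fun _ => []) from by
          funext k; rcases k with k | k <;> rfl)).trans
        (update_joint_inl h.tm (fun _ => []) (fun _ => []) v₀ w))
  have hhalt : ∀ (b : Bool) (x : Option G), TM2.stepAux k (x, h.tm.initialState)
      (joint h.tm (update (fun _ => []) v₁ (if b then [] else [x₁])) fun _ => []) =
        haltList M [res b] := by
    intro b x
    rw [haltList_eq]
    have hnil : update (update (fun _ => []) v₁ (if b then [] else [x₁])) v₁
        (if b then [] else [x₁]).tail = fun _ : V => ([] : List G) := by
      cases b <;> simp
    have hb : (if b then [] else [x₁]).head?.isNone = b := by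
      cases b <;> rfl
    simp only [k]
    rw [stepAux_pop_inl, stepAux_push_inr, update_self, hnil]
    simp only [hb, TM2.stepAux]
    exact congrArg (fun S => (⟨none, (none, h.tm.initialState), S⟩ :
      TM2.Cfg (alph V G h.tm) (Label h.tm c) (Reg G h.tm)))
      ((update_joint_inr h.tm (fun _ => []) (fun _ => []) h.tm.k₁ [res b]).symm.trans
        (congrArg (fun S => update S (Sum.inr h.tm.k₁) [res b]) (show
          joint h.tm (fun _ : V => ([] : List G)) (fun _ => []) = (fun _ => []) from by
            funext k; rcases k with k | k <;> rfl)))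
  rw [← hans] at key
  have run : ∀ i, ∃ n ≤ T.eval (enc i).length,
      (flip bind M.step)^[n] (some (initList M (enc i))) = some (haltList M [res (f i)]) := by
    intro i
    obtain ⟨n, hn, hE⟩ := key i
    obtain ⟨x, hx⟩ := steps_code h.tm inp out res hE (M := code h.tm inp out id k) id k
      (fun _ => rfl) none
    refine ⟨n, hn, ?_⟩
    rw [hinit, ← hhalt (f i) x]
    exact hx
  refine ⟨{ tm := M
            inputAlphabet := Equiv.refl G
            outputAlphabet := h.outputAlphabet
            time := T
            outputsFun := fun i =>
              { steps := (run i).choose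
                steps_le_m := (run i).choose_spec.1
                evals_in_steps := ?_ } }⟩
  have := (run i).choose_spec.2
  rw [show List.map (Equiv.refl G).invFun (enc i) = enc i from List.map_id _]
  exact this

end StackProg

/-! ### Derived programs -/

namespace StackProg

open Function

section Basic

variable {V G : Type} [DecidableEq V] {ans : Bool → G} {O : List G → Bool → ℕ → Prop}

theorem Runs.mono {c : Cmd V G} {S S' : V → List G} {m n : ℕ} (h : Runs ans O c S m S')
    (hmn : m ≤ n) : Runs ans O c S n S' :=
  let ⟨k, hk, he⟩ := h
  ⟨k, hk.trans hmn, he⟩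

theorem Runs.conv {c : Cmd V G} {S S₁ S₂ : V → List G} {m n : ℕ} (h : Runs ans O c S m S₁)
    (hmn : m ≤ n) (hS : S₁ = S₂) : Runs ans O c S n S₂ :=
  hS ▸ h.mono hmn

theorem Runs.skip (S : V → List G) : Runs ans O .skip S 1 S := ⟨1, le_rfl, .skip S⟩

theorem Runs.push (v : V) (a : G) (S : V → List G) :
    Runs ans O (.push v a) S 1 (update S v (a :: S v)) := ⟨1, le_rfl, .push v a S⟩

theorem Runs.pop (v : V) (S : V → List G) :
    Runs ans O (.pop v) S 1 (update S v (S v).tail) := ⟨1, le_rfl, .pop v S⟩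

theorem Runs.seq {c d : Cmd V G} {S S' S'' : V → List G} {m n : ℕ} (h : Runs ans O c S m S')
    (h' : Runs ans O d S' n S'') : Runs ans O (.seq c d) S (m + n) S'' :=
  let ⟨k, hk, he⟩ := h
  let ⟨l, hl, he'⟩ := h'
  ⟨k + l, Nat.add_le_add hk hl, .seq he he'⟩

theorem Runs.case {v : V} {f : Option G → Cmd V G} {S S' : V → List G} {n : ℕ} (o : Option G)
    (ho : (S v).head? = o) (h : Runs ans O (f o) S n S') :
    Runs ans O (.case v f) S (1 + n) S' := by
  subst ho
  obtain ⟨k, hk, he⟩ := h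
  exact ⟨1 + k, Nat.add_le_add_left hk 1, .case he⟩

theorem Runs.loop_done {v : V} {p : Option G → Bool} {c : Cmd V G} {S : V → List G}
    (h : p (S v).head? = false) : Runs ans O (.loop v p c) S 1 S :=
  ⟨1, le_rfl, .loop_done h⟩

theorem Runs.loop_step {v : V} {p : Option G → Bool} {c : Cmd V G} {S S' S'' : V → List G}
    {m n : ℕ} (hp : p (S v).head? = true) (h : Runs ans O c S m S')
    (h' : Runs ans O (.loop v p c) S' n S'') :
    Runs ans O (.loop v p c) S (1 + (m + n)) S'' :=
  let ⟨k, hk, he⟩ := h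
  let ⟨l, hl, he'⟩ := h'
  ⟨1 + (k + l), Nat.add_le_add_left (Nat.add_le_add hk hl) 1, .loop_step hp he he'⟩

theorem Runs.call {v : V} {S : V → List G} {b : Bool} {n : ℕ} (h : O (S v) b n) :
    Runs ans O (.call v) S n (update S v [ans b]) := ⟨n, le_rfl, .call h⟩

/-- Loops that consume a list of records, as a fold. -/
theorem Runs.loop_fold {β γ : Type} {v : V} {p : Option G → Bool} {c : Cmd V G}
    (st : List β → γ → V → List G) (f : γ → β → γ) (ok : List β → γ → Prop) {T : ℕ}
    (hcons : ∀ b L x, ok (b :: L) x → p (st (b :: L) x v).head? = true)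
    (hnil : ∀ x, ok [] x → p (st [] x v).head? = false)
    (hbody : ∀ b L x, ok (b :: L) x → Runs ans O c (st (b :: L) x) T (st L (f x b)))
    (hok : ∀ b L x, ok (b :: L) x → ok L (f x b)) (L : List β) :
    ∀ x, ok L x → Runs ans O (.loop v p c) (st L x) (L.length * (T + 1) + 1)
      (st [] (L.foldl f x)) := by
  induction L with
  | nil => exact fun x hx => (Runs.loop_done (hnil x hx)).mono (by simp)
  | cons b L ih =>
    intro x hx
    refine (Runs.loop_step (hcons b L x hx) (hbody b L x hx) (ih _ (hok b L x hx))).mono ?_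
    rw [List.length_cons, Nat.add_mul]
    omega

/-- Push a symbol on several stacks. -/
def pushAll (a : G) : List V → Cmd V G
  | [] => .skip
  | y :: ys => .seq (.push y a) (pushAll a ys)

theorem runs_pushAll (a : G) (ys : List V) (hys : ys.Nodup) : ∀ S : V → List G,
    Runs ans O (pushAll a ys) S (ys.length + 1) fun v => if v ∈ ys then a :: S v else S v := by
  induction ys with
  | nil => exact fun S => (Runs.skip S).conv le_rfl (by simp)
  | cons y ys ih =>
    intro S
    rw [List.nodup_cons] at hys
    have := (Runs.push y a S).seq (ih hys.2 (update S y (a :: S y)))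
    rw [List.length_cons, add_comm, pushAll]
    convert this using 1
    funext v
    by_cases h : v = y
    · subst h; simp [hys.1]
    · simp [h]

/-- Move the symbols from the top of the stack `x` to all stacks in `ys`, as long as they have the
property `p`. -/
def scan (p : G → Bool) (x : V) (ys : List V) : Cmd V G :=
  .loop x (fun o => o.any p) (.case x fun o => o.elim .skip fun a =>
    .seq (.pop x) (pushAll a ys))

/-- Each symbol costs the loop test, the case distinction, the pop and the `ys.length + 1` steps of
`pushAll`; the last summand is the failing test. The condition `hr` makes the loop stop exactly at
`r`. -/
theorem runs_scan (p : G → Bool) {x : V} {ys : List V} (hys : (x :: ys).Nodup) {r : List G}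
    (hr : r.head?.any p = false) (w : List G) (hw : ∀ a ∈ w, p a = true) :
    ∀ S : V → List G, S x = w ++ r →
      Runs ans O (scan p x ys) S (w.length * (ys.length + 4) + 1) fun v =>
        if v = x then r else if v ∈ ys then w.reverse ++ S v else S v := by
  rw [List.nodup_cons] at hys
  induction w with
  | nil =>
    intro S hS
    have : (fun v => if v = x then r else if v ∈ ys then [].reverse ++ S v else S v) = S := by
      funext v
      by_cases h : v = x
      · subst h; simpa using hS.symm
      · simp [h]
    rw [this]
    exact (Runs.loop_done (by rw [hS]; exact hr)).mono (by simp)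
  | cons a w ih =>
    intro S hS
    have h₁ := (Runs.pop x S).seq (runs_pushAll (ans := ans) (O := O) a ys hys.2
      (update S x (S x).tail))
    have h₂ := ih (fun b hb => hw b (List.mem_cons_of_mem a hb))
      (fun v => if v ∈ ys then a :: update S x (S x).tail v else update S x (S x).tail v)
      (by simp [hys.1, hS])
    refine (Runs.loop_step (by simpa [hS] using hw a) (Runs.case (some a) (by simp [hS]) h₁)
      h₂).conv ?_ ?_
    · rw [List.length_cons, Nat.add_mul]
      omega
    · funext v
      by_cases h : v = x
      · simp [h]
      · by_cases h' : v ∈ ys <;> simp [h, h']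

/-- Empty a stack. -/
def clear (x : V) : Cmd V G := scan (fun _ => true) x []

theorem runs_clear (x : V) (S : V → List G) {B : ℕ} (hB : (S x).length ≤ B) :
    Runs ans O (clear x) S (4 * B + 1) (update S x []) := by
  have := runs_scan (ans := ans) (O := O) (fun _ => true) (x := x) (ys := []) (by simp) (r := [])
    rfl (S x) (by simp) S (by simp)
  refine this.conv ?_ ?_
  · simp only [List.length_nil]; omega
  · funext v
    by_cases h : v = x
    · subst h; simp
    · simp [h]

/-- Move a stack on another one, in reverse order. -/
def move (x y : V) : Cmd V G := scan (fun _ => true) x [y]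

theorem runs_move {x y : V} (hxy : x ≠ y) (S : V → List G) {B : ℕ} (hB : (S x).length ≤ B) :
    Runs ans O (move x y) S (5 * B + 1) (update (update S x []) y ((S x).reverse ++ S y)) := by
  have := runs_scan (ans := ans) (O := O) (fun _ => true) (x := x) (ys := [y]) (by simpa)
    (r := []) rfl (S x) (by simp) S (by simp)
  refine this.conv ?_ ?_
  · simp only [List.length_singleton]; omega
  · funext v
    by_cases h : v = x
    · subst h; simp [hxy]
    · by_cases h' : v = y
      · subst h'; simp [h]
      · simp [h, h']

/-- Copy a stack on top of another one, with an auxiliary stack `t`. -/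
def copy (x y t : V) : Cmd V G := .seq (move x t) (scan (fun _ => true) t [x, y])

/-- Moving to `t` reverses the word, and scanning back to both stacks restores its order. -/
theorem runs_copy {x y t : V} (h : [t, x, y].Nodup) (S : V → List G) (ht : S t = []) {B : ℕ}
    (hB : (S x).length ≤ B) :
    Runs ans O (copy x y t) S (11 * B + 2) (update S y (S x ++ S y)) := by
  have hx : x ≠ t := by rintro rfl; simp at h
  have hy : y ≠ t := by rintro rfl; simp at h
  have hxy : x ≠ y := by rintro rfl; simp at h
  have h₁ := runs_move (ans := ans) (O := O) hx S hB
  have h₂ := runs_scan (ans := ans) (O := O) (fun _ => true) h (r := []) rfl (S x).reverse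
    (by simp) (update (update S x []) t ((S x).reverse ++ S t)) (by simp [ht])
  refine (h₁.seq h₂).conv ?_ ?_
  · simp only [List.length_reverse, List.length_cons, List.length_nil]; omega
  · funext v
    by_cases hv : v = t
    · subst hv; simp [hy.symm, ht]
    · by_cases hv' : v = x
      · subst hv'; simp [hv, hxy]
      · by_cases hv'' : v = y
        · subst hv''; simp [hv, hv']
        · simp [hv, hv', hv'']

variable [DecidableEq G]

/-- Move the symbols of `x` before the separator `s` to the stack `y`, in reverse order, and drop
the separator. -/
def readUntil (s : G) (x y : V) : Cmd V G := .seq (scan (fun a => a ≠ s) x [y]) (.pop x)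

theorem runs_readUntil {s : G} {x y : V} (hxy : x ≠ y) (S : V → List G) {w r : List G}
    (hS : S x = w ++ s :: r) (hw : s ∉ w) {B : ℕ} (hB : w.length ≤ B) :
    Runs ans O (readUntil s x y) S (5 * B + 2) (update (update S x r) y (w.reverse ++ S y)) := by
  have h₁ := runs_scan (ans := ans) (O := O) (fun a => a ≠ s) (x := x) (ys := [y]) (by simpa)
    (r := s :: r) (by simp) w (fun a ha => by simpa using ne_of_mem_of_not_mem ha hw) S hS
  refine (h₁.seq (Runs.pop x _)).conv ?_ ?_
  · simp only [List.length_singleton]; omega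
  · funext v
    by_cases h : v = x
    · subst h; simp [hxy]
    · by_cases h' : v = y
      · subst h'; simp [h]
      · simp [h, h']

/-- Drop the symbols of `x` up to the separator `s`. -/
def dropUntil (s : G) (x : V) : Cmd V G := .seq (scan (fun a => a ≠ s) x []) (.pop x)

theorem runs_dropUntil {s : G} {x : V} (S : V → List G) {w r : List G}
    (hS : S x = w ++ s :: r) (hw : s ∉ w) {B : ℕ} (hB : w.length ≤ B) :
    Runs ans O (dropUntil s x) S (4 * B + 2) (update S x r) := by
  have h₁ := runs_scan (ans := ans) (O := O) (fun a => a ≠ s) (x := x) (ys := []) (by simp)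
    (r := s :: r) (by simp) w (fun a ha => by simpa using ne_of_mem_of_not_mem ha hw) S hS
  refine (h₁.seq (Runs.pop x _)).conv ?_ ?_
  · simp only [List.length_nil]; omega
  · funext v
    by_cases h : v = x
    · subst h; simp
    · simp [h]

end Basic

end StackProg

/-! ### Comparison and lookup of names -/

namespace DataTree

open Function StackProg

namespace Universality

/-- The stacks of the universality test. -/
inductive Var : Type
  /-- the input -/
  | inp
  /-- the final states -/
  | fin
  /-- the horizontal transitions -/
  | tr
  /-- the vertical rules -/
  | ru
  /-- the horizontal states that are known to be accessible -/
  | hs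
  /-- the vertical states that are known to be accessible -/
  | vs
  /-- the remaining rounds -/
  | cnt
  /-- marked if a condition is violated -/
  | bad
  | tr2 | ru2 | hs2 | vs2 | m | a | b | c | f | e | o | tmp | hit | neq
  deriving DecidableEq

instance : Finite Var :=
  Finite.of_injective (fun x : Var => (⟨x.ctorIdx, by cases x <;> decide⟩ : Fin 22))
    fun x y h => by cases x <;> cases y <;> first | rfl | cases h

variable {α : Type} {ans : Bool → Sym α} {O : List (Sym α) → Bool → ℕ → Prop}

/-- Programs of the universality test. -/
abbrev Prog (α : Type) : Type := Cmd Var (Sym α)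

/-- A flag, as the contents of a stack. -/
def flag : Bool → List (Sym α)
  | true => [Sym.sep]
  | false => []

@[simp] theorem flag_true : (flag true : List (Sym α)) = [Sym.sep] := rfl

@[simp] theorem flag_false : (flag false : List (Sym α)) = [] := rfl

/-- Set a flag. -/
def mark (v : Var) : Prog α := .case v fun o => o.elim (.push v Sym.sep) fun _ => .skip

theorem runs_mark (v : Var) (S : Var → List (Sym α)) {h : Bool} (hS : S v = flag h) :
    Runs ans O (mark v) S 2 (update S v (flag true)) := by
  cases h
  · exact (Runs.case none (by rw [hS]; rfl) (Runs.push v Sym.sep S)).conv le_rfl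
      (by rw [hS]; rfl)
  · exact (Runs.case (some Sym.sep) (by rw [hS]; rfl) (Runs.skip S)).conv le_rfl
      (by rw [← hS, update_eq_self])

/-- Run one of two programs, according to a flag, and reset the flag. -/
def branch (v : Var) (c d : Prog α) : Prog α :=
  .case v fun o => o.elim d fun _ => .seq (.pop v) c

theorem runs_branch_true {v : Var} {c d : Prog α} {S S' : Var → List (Sym α)} {n : ℕ}
    (hS : S v = [Sym.sep]) (h : Runs ans O c (update S v []) n S') :
    Runs ans O (branch v c d) S (n + 2) S' := by
  have := (Runs.pop (ans := ans) (O := O) v S).seq (n := n) (S'' := S') (by rwa [hS])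
  exact (Runs.case (some Sym.sep) (by rw [hS]; rfl) this).mono (by omega)

theorem runs_branch_false {v : Var} {c d : Prog α} {S S' : Var → List (Sym α)} {n : ℕ}
    (hS : S v = []) (h : Runs ans O d S n S') : Runs ans O (branch v c d) S (n + 2) S' :=
  (Runs.case none (by rw [hS]; rfl) h).mono (by omega)

theorem length_le_length_flatMap {β : Type} {g : β → List (Sym α)} (hg : ∀ r, g r ≠ [])
    (L : List β) : L.length ≤ (L.flatMap g).length := by
  induction L with
  | nil => simp
  | cons r L ih =>
    have := List.length_pos_iff.2 (hg r)
    rw [List.flatMap_cons, List.length_append, List.length_cons]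
    omega

variable [DecidableEq (Sym α)]

/-- Compare the top symbols of `c` and `b`. -/
def matchTop : Prog α :=
  .case .c fun o => o.elim .skip fun x => .seq (.pop .c)
    (.case .b fun o' => o'.elim (mark .neq) fun y =>
      .seq (.pop .b) (if x = y then .skip else mark .neq))

/-- Test whether `c` is a prefix of `b`. -/
theorem runs_matchTops (u : List (Sym α)) : ∀ (S : Var → List (Sym α)) (n : Bool),
    S .c = u → S .neq = flag n →
      Runs ans O (.loop .c Option.isSome matchTop) S (7 * u.length + 1)
        (update (update (update S .c []) .b ((S .b).drop u.length)) .neq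
          (flag (n || !decide (u <+: S .b)))) := by
  induction u with
  | nil =>
    intro S n hc hn
    refine (Runs.loop_done (by rw [hc]; rfl)).conv (by simp) ?_
    funext v
    cases v <;> simp [hc, hn]
  | cons x u ih =>
    intro S n hc hn
    have hp := Runs.pop (ans := ans) (O := O) Var.c S
    match hb : S .b with
    | [] =>
      have h₁ := runs_mark (ans := ans) (O := O) .neq (update S .c (S .c).tail) (h := n) (by simpa)
      have h₂ := hp.seq (Runs.case (v := .b) (f := fun o' => o'.elim (mark .neq) fun y =>
        .seq (.pop .b) (if x = y then .skip else mark .neq)) none (by simp [hb]) h₁)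
      refine (Runs.loop_step (by simp [hc]) (Runs.case (some x) (by rw [hc]; rfl) h₂)
        (ih _ true (by simp [hc]) (by simp))).conv ?_ ?_
      · rw [List.length_cons]; omega
      · funext v
        cases v <;> simp [hb]
    | y :: t =>
      by_cases hxy : x = y
      · subst hxy
        have h₁ := (Runs.pop (ans := ans) (O := O) Var.b (update S .c (S .c).tail)).seq
          (d := if x = x then .skip else mark .neq) (by rw [if_pos rfl]; exact Runs.skip _)
        have h₂ := hp.seq (Runs.case (v := .b) (f := fun o' => o'.elim (mark .neq) fun y =>
          .seq (.pop .b) (if x = y then .skip else mark .neq)) (some x) (by simp [hb]) h₁)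
        refine (Runs.loop_step (by simp [hc]) (Runs.case (some x) (by rw [hc]; rfl) h₂)
          (ih _ n (by simp [hc]) (by simpa))).conv ?_ ?_
        · rw [List.length_cons]; omega
        · funext v
          cases v <;> simp [hb]
      · have h₁ := (Runs.pop (ans := ans) (O := O) Var.b (update S .c (S .c).tail)).seq
          (d := if x = y then .skip else mark .neq)
          (by rw [if_neg hxy]; exact runs_mark .neq _ (h := n) (by simpa))
        have h₂ := hp.seq (Runs.case (v := .b) (f := fun o' => o'.elim (mark .neq) fun y =>
          .seq (.pop .b) (if x = y then .skip else mark .neq)) (some y) (by simp [hb]) h₁)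
        refine (Runs.loop_step (by simp [hc]) (Runs.case (some x) (by rw [hc]; rfl) h₂)
          (ih _ true (by simp [hc]) (by simp))).conv ?_ ?_
        · rw [List.length_cons]; omega
        · funext v
          cases v <;> simp [hb, hxy]

/-- Compare `a` with `b`, delete `b`, and set the flag `hit` if they are equal. -/
def compare : Prog α :=
  .seq (copy .a .c .tmp) <| .seq (.loop .c Option.isSome matchTop) <|
    .seq (.case .b fun o => o.elim .skip fun _ => .seq (mark .neq) (clear .b)) <|
      branch .neq .skip (mark .hit)

/-- A time bound for `compare`. -/
def compareTime (B : ℕ) : ℕ := 22 * B + 12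

theorem runs_compare (S : Var → List (Sym α)) {h : Bool} {B : ℕ} (ha : (S .a).length ≤ B)
    (hb : (S .b).length ≤ B) (hc : S .c = []) (hneq : S .neq = []) (htmp : S .tmp = [])
    (hhit : S .hit = flag h) :
    Runs ans O compare S (compareTime B)
      (update (update S .b []) .hit (flag (h || decide (S .a = S .b)))) := by
  have h₁ := runs_copy (ans := ans) (O := O) (x := Var.a) (y := Var.c) (t := Var.tmp) (by simp) S
    htmp ha
  have h₂ := runs_matchTops (ans := ans) (O := O) (S .a) (update S .c (S .a ++ S .c)) false
    (by simp [hc]) (by simpa)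
  have hend : ∀ (S' : Var → List (Sym α)) (n : Bool), S' .neq = flag n → S' .hit = flag h →
      Runs ans O (branch .neq .skip (mark .hit)) S' 4
        (update (update S' .neq []) .hit (flag (h || !n))) := by
    intro S' n hn hh
    cases n
    · refine (runs_branch_false hn (runs_mark .hit S' hh)).conv le_rfl ?_
      funext v
      cases v <;> simp [hn]
    · refine (runs_branch_true hn (Runs.skip _)).conv (by omega) ?_
      funext v
      cases v <;> simp [hh]
  by_cases hd : (S .b).drop (S .a).length = []
  · have hnil : ∀ S' : Var → List (Sym α), S' .b = [] → Runs ans O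
        (.case .b fun o => o.elim .skip fun _ => .seq (mark .neq) (clear .b)) S' 2 S' :=
      fun S' hS' => (Runs.case (v := Var.b) none (by rw [hS']; rfl) (Runs.skip S')).mono le_rfl
    refine (h₁.seq (h₂.seq ((hnil _ (by simp [hd])).seq
      (hend _ (!decide (S .a <+: S .b)) (by simp) (by simpa))))).conv ?_ ?_
    · rw [compareTime]; omega
    -- Nothing of `b` is left after dropping the length of `a`, so `b` is no longer than `a`.
    · have : S .a <+: S .b ↔ S .a = S .b := by
        constructor
        · rintro ⟨t, ht⟩
          rw [← ht] at hd ⊢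
          simp at hd
          simp [hd]
        · intro h; rw [h]
      funext v
      cases v <;> simp [hd, hc, hneq, this]
  · have hcons : ∀ (S' : Var → List (Sym α)) (n : Bool), S' .b = (S .b).drop (S .a).length →
        S' .neq = flag n → Runs ans O
        (.case .b fun o => o.elim .skip fun _ => .seq (mark .neq) (clear .b)) S' (4 * B + 4)
        (update (update S' .neq (flag true)) .b []) := by
      intro S' n hb' hn
      obtain ⟨x, hx⟩ := Option.isSome_iff_exists.1
        (List.isSome_head?.2 (by rwa [hb']) : (S' .b).head?.isSome)
      refine (Runs.case (some x) hx ((runs_mark .neq S' hn).seq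
        (runs_clear .b _ (B := B) ?_))).conv (by omega) rfl
      simp [hb']
      omega
    refine (h₁.seq (h₂.seq ((hcons _ (!decide (S .a <+: S .b)) (by simp) (by simp)).seq
      (hend _ true (by simp) (by simpa))))).conv ?_ ?_
    · rw [compareTime]; omega
    · have : S .a ≠ S .b := by
        intro h; rw [h] at hd; simp at hd
      funext v
      cases v <;> simp [hc, hneq, this]

/-- Search the list of records `x` for a record whose first component is `a`, and set the flag
`hit` if there is one. The program `sk` removes the rest of a record from `m`. -/
def lookup (x : Var) (sk : Prog α) : Prog α :=
  .seq (copy x .m .tmp) <| .loop .m Option.isSome <|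
    .seq (readUntil Sym.sep .m .b) <| .seq sk compare

/-- A time bound for `lookup`. -/
def lookupTime (B : ℕ) : ℕ := 11 * B + 2 + (B * (9 * B + 4 + compareTime B + 1) + 1)

theorem foldl_or {β : Type} (p : β → Bool) (L : List β) :
    ∀ h : Bool, L.foldl (fun h r => h || p r) h = (h || decide (∃ r ∈ L, p r)) := by
  induction L with
  | nil => simp
  | cons r L ih =>
    intro h
    rw [List.foldl_cons, ih]
    cases h <;> cases hp : p r <;> simp [hp]

/-- Keys arrive reversed on `b` because `readUntil` reverses them; this is why the key in `a` is
stored reversed as well. The loop folds a disjunction over the records. -/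
theorem runs_lookup {β : Type} (L : List β) (key rest : β → List (Sym α))
    (hkey : ∀ r, Sym.sep ∉ key r) (x : Var) (hx : [.tmp, x, .m].Nodup) {sk : Prog α} {B : ℕ}
    (hsk : ∀ r (S : Var → List (Sym α)) (w : List (Sym α)), S .m = rest r ++ w →
      (rest r).length ≤ B → Runs ans O sk S (4 * B + 2) (update S .m w))
    (S : Var → List (Sym α)) {k : List (Sym α)} (hL : S x = L.flatMap fun r => key r ++ Sym.sep :: rest r)
    (hB : (S x).length ≤ B) (ha : S .a = k.reverse) (hka : k.length ≤ B) (hm : S .m = [])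
    (hb : S .b = []) (hc : S .c = []) (hneq : S .neq = []) (htmp : S .tmp = [])
    (hhit : S .hit = []) :
    Runs ans O (lookup x sk) S (lookupTime B)
      (update S .hit (flag (decide (∃ r ∈ L, key r = k)))) := by
  have h₁ := runs_copy (ans := ans) (O := O) hx S htmp hB
  have h₂ := Runs.loop_fold (ans := ans) (O := O) (v := Var.m) (p := Option.isSome)
    (c := .seq (readUntil Sym.sep .m .b) <| .seq sk compare) (T := 9 * B + 4 + compareTime B)
    (st := fun (L : List β) (h : Bool) =>
      update (update S .m (L.flatMap fun r => key r ++ Sym.sep :: rest r)) .hit (flag h))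
    (f := fun h r => h || decide (key r = k))
    (ok := fun L _ => (L.flatMap fun r => key r ++ Sym.sep :: rest r).length ≤ B)
    (by
      intro r L h _
      simp)
    (by simp)
    (by
      intro r L h hok
      simp only [List.flatMap_cons, List.length_append, List.length_cons] at hok
      refine ((runs_readUntil (by simp) _ (w := key r)
        (r := rest r ++ L.flatMap fun r => key r ++ Sym.sep :: rest r) (by simp) (hkey r)
        (B := B) (by omega)).seq ((hsk r _ (L.flatMap fun r => key r ++ Sym.sep :: rest r)
          (by simp) (by omega)).seq (runs_compare (h := h) _ (B := B) ?_ ?_ ?_ ?_ ?_ ?_))).conv ?_ ?_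
      · simpa [ha]
      · simp [hb]; omega
      · simpa
      · simpa
      · simpa
      · simp
      · omega
      · have : k = key r ↔ key r = k := eq_comm
        funext v
        cases v <;> simp [ha, hb, this])
    (by
      intro r L h hok
      simp only [List.flatMap_cons, List.length_append] at hok
      omega) L false (by rwa [hL] at hB)
  have hlen := length_le_length_flatMap (g := fun r => key r ++ Sym.sep :: rest r) (by simp) L
  rw [← hL] at hlen
  -- The stacks after copying are the start of the fold with accumulator `false`, since `hit` is
  -- empty.
  rw [show update (update S .m (L.flatMap fun r => key r ++ Sym.sep :: rest r)) .hit (flag false) =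
    update S .m (S x ++ S .m) by
      funext v
      cases v <;> simp [hL, hm, hhit]] at h₂
  refine (h₁.seq h₂).conv ?_ ?_
  · rw [lookupTime]
    gcongr
    omega
  · rw [foldl_or]
    funext v
    cases v <;> simp [hm]

end Universality

end DataTree

/-! ### Saturation rounds -/

namespace DataTree

open Function StackProg

namespace Universality

variable {α : Type} {P : Set (Pattern α)}

/-- The encoding of a list of names. -/
def encNames (L : List ℕ) : List (Sym α) := L.flatMap encodeItem

/-- The encoding of a vertical rule `(p₀, p) → q`, given as `(p, q)`. -/
def encRule (r : ℕ × ℕ) : List (Sym α) := encodeItem r.1 ++ encodeItem r.2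

/-- The encoding of a horizontal transition. -/
def encTrans (t : ℕ × Filt P × ℕ) : List (Sym α) :=
  encodeItem t.1 ++ t.2.1.encode ++ [Sym.sep] ++ encodeItem t.2.2

theorem sep_notMem_encodeName (n : ℕ) : (Sym.sep : Sym α) ∉ encodeName n := by
  simp [encodeName]

theorem close_notMem_encodeName (n : ℕ) : (Sym.close : Sym α) ∉ encodeName n := by
  simp [encodeName]

theorem notMem_encode_pattern (x : Pattern α) :
    (Sym.sep : Sym α) ∉ x.encode ∧ (Sym.close : Sym α) ∉ x.encode := by
  induction x with
  | word d => simp [Pattern.encode]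
  | cat x y ihx ihy | alt x y ihx ihy => simp [Pattern.encode, ihx, ihy]
  | star x ih => simp [Pattern.encode, ih]

/-- Separators do not occur inside fields, so `readUntil` and `dropUntil` stop at the end of the
intended field. -/
theorem notMem_encode_filt (f : Filt P) :
    (Sym.sep : Sym α) ∉ f.encode ∧ (Sym.close : Sym α) ∉ f.encode := by
  induction f with
  | pat x => exact notMem_encode_pattern x.1
  | state q => simp [Filt.encode, sep_notMem_encodeName, close_notMem_encodeName]
  | and f g ihf ihg => simp [Filt.encode, ihf, ihg]
  | not f ih => simp [Filt.encode, ih]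

theorem encodeName_injective : Injective (encodeName : ℕ → List (Sym α)) := by
  intro m n h
  have h' : Computability.encodeNat m = Computability.encodeNat n :=
    List.map_injective_iff.2 (fun x y hxy => by simpa using hxy) h
  rw [← Computability.decode_encodeNat m, h', Computability.decode_encodeNat]

theorem encNames_cons (n : ℕ) (L : List ℕ) :
    (encNames (n :: L) : List (Sym α)) = encodeName n ++ Sym.sep :: encNames L := by
  simp [encNames, encodeItem]

/-! ### Validity queries -/

open Classical in
/-- Singleton-validity as a Boolean. -/
noncomputable def valid (f : Filt P) : Bool := decide f.SingletonValid

theorem valid_eq_true_iff (f : Filt P) : valid f = true ↔ f.SingletonValid :=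
  by classical exact decide_eq_true_iff

/-- The filter is satisfied by `(d, {q})` for some `d`. -/
def Satisfiable (f : Filt P) (q : ℕ) : Prop := ∃ d : List α, f.Sat d {q}

/-- A set with at most one element that contains `q` is `{q}`. Conjunction with the property `q`
therefore singles out the pairs `(d, {q})`. -/
theorem valid_not_and (f : Filt P) (q : ℕ) :
    valid (.not (.and f (.state q))) = false ↔ Satisfiable f q := by
  rw [valid, decide_eq_false_iff_not, Filt.SingletonValid]
  push Not
  constructor
  · rintro ⟨d, Q, hQ, h⟩
    simp only [Filt.Sat, not_not] at h
    exact ⟨d, hQ.eq_singleton_of_mem h.2 ▸ h.1⟩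
  · rintro ⟨d, h⟩
    exact ⟨d, {q}, Set.subsingleton_singleton, by simpa [Filt.Sat] using h⟩

/-- The filter `q ∧ ¬ f₁ ∧ … ∧ ¬ fₙ`. -/
def avoid (fs : List (Filt P)) (q : ℕ) : Filt P :=
  fs.foldr (fun f g => .and (.not f) g) (.state q)

theorem sat_avoid (fs : List (Filt P)) (q : ℕ) (d : List α) (Q : Set ℕ) :
    (avoid fs q).Sat d Q ↔ q ∈ Q ∧ ∀ f ∈ fs, ¬ f.Sat d Q := by
  induction fs with
  | nil => simp [avoid, Filt.Sat]
  | cons f fs ih =>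
    have : (avoid (f :: fs) q).Sat d Q ↔ ¬ f.Sat d Q ∧ (avoid fs q).Sat d Q := Iff.rfl
    rw [this, ih, List.forall_mem_cons]
    tauto

/-- For the outgoing filters of a state, this is the condition that every data value can be read
together with `{q}`. -/
theorem valid_not_avoid (fs : List (Filt P)) (q : ℕ) :
    valid (.not (avoid fs q)) = true ↔ ∀ d : List α, ∃ f ∈ fs, f.Sat d {q} := by
  rw [valid_eq_true_iff, Filt.SingletonValid]
  constructor
  · intro h d
    have := h d {q} Set.subsingleton_singleton
    rw [Filt.Sat, sat_avoid] at this
    push Not at this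
    exact this rfl
  · intro h d Q hQ
    rw [Filt.Sat, sat_avoid]
    rintro ⟨hq, hn⟩
    rw [hQ.eq_singleton_of_mem hq] at hn
    obtain ⟨f, hf, hs⟩ := h d
    exact hn f hf hs

/-- The conjunction is nested to the right and ends with the property. In Polish notation the
filters then contribute consecutive blocks, which a program can append one at a time. -/
theorem encode_avoid (fs : List (Filt P)) (q : ℕ) :
    (avoid fs q).encode =
      (fs.flatMap fun f => Sym.and :: Sym.not :: f.encode) ++ Sym.state :: encodeName q := by
  induction fs with
  | nil => rfl
  | cons f fs ih =>
    have : (avoid (f :: fs) q).encode = Sym.and :: ((Sym.not :: f.encode) ++ (avoid fs q).encode) :=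
      rfl
    rw [this, ih]
    simp

/-- The working stacks are empty. -/
structure Clean (S : Var → List (Sym α)) : Prop where
  a : S .a = []
  b : S .b = []
  c : S .c = []
  e : S .e = []
  f : S .f = []
  m : S .m = []
  o : S .o = []
  tmp : S .tmp = []
  hit : S .hit = []
  neq : S .neq = []
  tr2 : S .tr2 = []
  ru2 : S .ru2 = []
  hs2 : S .hs2 = []
  vs2 : S .vs2 = []

variable {ans : Bool → Sym α} {O : List (Sym α) → Bool → ℕ → Prop} [DecidableEq (Sym α)]

theorem runs_lookup_names (L : List ℕ) (x : Var) (hx : [.tmp, x, .m].Nodup) {B : ℕ}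
    (S : Var → List (Sym α)) {n : ℕ} (hL : S x = encNames L) (hB : (S x).length ≤ B)
    (ha : S .a = (encodeName n).reverse) (hn : (encodeName n : List (Sym α)).length ≤ B)
    (hm : S .m = []) (hb : S .b = []) (hc : S .c = []) (hneq : S .neq = []) (htmp : S .tmp = [])
    (hhit : S .hit = []) :
    Runs ans O (lookup x .skip) S (lookupTime B) (update S .hit (flag (decide (n ∈ L)))) := by
  have := runs_lookup (ans := ans) (O := O) L encodeName (fun _ => []) sep_notMem_encodeName x hx
    (sk := .skip) (B := B) (by
      intro r S w hw _
      refine (Runs.skip S).conv (by omega) ?_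
      funext v
      cases v <;> simp [hw]) S (k := encodeName n) hL hB ha hn hm hb hc hneq htmp hhit
  simpa [encodeName_injective.eq_iff] using this

theorem runs_lookup_rules (L : List (ℕ × ℕ)) (x : Var) (hx : [.tmp, x, .m].Nodup) {B : ℕ}
    (S : Var → List (Sym α)) {n : ℕ} (hL : S x = L.flatMap encRule) (hB : (S x).length ≤ B)
    (ha : S .a = (encodeName n).reverse) (hn : (encodeName n : List (Sym α)).length ≤ B)
    (hm : S .m = []) (hb : S .b = []) (hc : S .c = []) (hneq : S .neq = []) (htmp : S .tmp = [])
    (hhit : S .hit = []) :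
    Runs ans O (lookup x (dropUntil Sym.sep .m)) S (lookupTime B)
      (update S .hit (flag (decide (∃ r ∈ L, r.1 = n)))) := by
  have := runs_lookup (ans := ans) (O := O) L (fun r => encodeName r.1) (fun r => encodeItem r.2)
    (fun r => sep_notMem_encodeName r.1) x hx
    (sk := dropUntil Sym.sep .m) (B := B) (by
      intro r S w hw hB
      rw [encodeItem, List.append_assoc] at hw
      refine runs_dropUntil S hw (sep_notMem_encodeName r.2) ?_
      rw [encodeItem, List.length_append] at hB
      omega) S (k := encodeName n) (by rw [hL]; congr 1; funext r; simp [encRule, encodeItem]) hB ha hn hm hb hc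
      hneq htmp hhit
  have hiff : ∀ r : ℕ × ℕ, (encodeName r.1 : List (Sym α)) = encodeName n ↔ r.1 = n :=
    fun r => encodeName_injective.eq_iff
  simpa only [hiff] using this

/-- Apply a vertical rule. -/
def ruleBody : Prog α :=
  .seq (readUntil Sym.sep .ru2 .a) <| .seq (readUntil Sym.sep .ru2 .f) <|
  .seq (lookup .hs .skip) <|
  .seq (branch .hit (.seq (.push .vs Sym.sep) (move .f .vs)) (clear .f)) <| clear .a

/-- A time bound for `ruleBody`. -/
def ruleBodyTime (B : ℕ) : ℕ := lookupTime B + 20 * B + 10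

/-- The effect of the vertical rules on the list of accessible vertical states. -/
def addV (H : List ℕ) (R : List (ℕ × ℕ)) (V : List ℕ) : List ℕ :=
  R.foldl (fun V r => if r.1 ∈ H then r.2 :: V else V) V

theorem runs_ruleBody (S : Var → List (Sym α)) {H V : List ℕ} {r : ℕ × ℕ} {w : List (Sym α)}
    {B : ℕ} (hr : S .ru2 = encRule r ++ w) (hrB : (S .ru2).length ≤ B) (hH : S .hs = encNames H)
    (hHB : (S .hs).length ≤ B) (hV : S .vs = encNames V) (ha : S .a = []) (hf : S .f = [])
    (hm : S .m = []) (hb : S .b = []) (hc : S .c = []) (hneq : S .neq = []) (htmp : S .tmp = [])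
    (hhit : S .hit = []) :
    Runs ans O ruleBody S (ruleBodyTime B) (update (update S .ru2 w) .vs
      (encNames (if r.1 ∈ H then r.2 :: V else V))) := by
  have hlen := hrB
  simp only [hr, encRule, encodeItem, List.length_append, List.length_singleton] at hlen
  have h₁ := runs_readUntil (ans := ans) (O := O) (s := Sym.sep) (x := Var.ru2) (y := Var.a)
    (by simp) S (w := encodeName r.1) (r := encodeItem r.2 ++ w)
    (by simp [hr, encRule, encodeItem]) (sep_notMem_encodeName _) (B := B) (by omega)
  have h₂ : ∀ S' : Var → List (Sym α), S' .hit = flag (decide (r.1 ∈ H)) →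
      S' .f = (encodeName r.2).reverse → S' .vs = encNames V →
      Runs ans O (branch .hit (.seq (.push .vs Sym.sep) (move .f .vs)) (clear .f)) S' (5 * B + 4)
        (update (update (update S' .hit []) .f []) .vs
          (encNames (if r.1 ∈ H then r.2 :: V else V))) := by
    intro S' hh hf' hv
    by_cases h : r.1 ∈ H
    · refine (runs_branch_true (v := .hit) (S := S') (by simp [hh, h]) ((Runs.push .vs Sym.sep _).seq
        (runs_move (x := .f) (y := .vs) (by simp) _ (B := B) ?_))).conv ?_ ?_
      · simp [hf']; omega
      · omega
      · funext v
        cases v <;> simp [h, hf', hv, encNames_cons]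
    · refine (runs_branch_false (v := .hit) (S := S') (by simp [hh, h]) (runs_clear .f _ (B := B) ?_)).conv ?_ ?_
      · simp [hf']; omega
      · omega
      · funext v
        cases v <;> simp [h, hh, hv]
  refine (h₁.seq ((runs_readUntil (x := Var.ru2) (y := Var.f) (by simp) _ (w := encodeName r.2)
    (r := w) (by simp [encodeItem]) (sep_notMem_encodeName _) (B := B) (by omega)).seq
    ((runs_lookup_names H .hs (by simp) (B := B) (n := r.1) _ (by simpa) (by simpa) (by simp [ha])
      (by omega) (by simpa) (by simpa) (by simpa) (by simpa) (by simpa) (by simpa)).seq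
    ((h₂ _ (by simp) (by simp [hf]) (by simpa)).seq (runs_clear .a _ (B := B) ?_))))).conv ?_ ?_
  · simp [ha]; omega
  · rw [ruleBodyTime]; omega
  · funext v
    cases v <;> simp [ha, hf, hhit]

/-- Apply all vertical rules. -/
def ruleStep : Prog α :=
  .seq (copy .ru .ru2 .tmp) (.loop .ru2 Option.isSome ruleBody)

/-- A time bound for `ruleStep`. -/
def ruleStepTime (B : ℕ) : ℕ := 11 * B + 2 + (B * (ruleBodyTime B + 1) + 1)

theorem runs_ruleStep {S : Var → List (Sym α)} (hS : Clean S) {H V : List ℕ} {R : List (ℕ × ℕ)}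
    {B : ℕ} (hR : S .ru = R.flatMap encRule) (hRB : (S .ru).length ≤ B) (hH : S .hs = encNames H)
    (hHB : (S .hs).length ≤ B) (hV : S .vs = encNames V) :
    Runs ans O ruleStep S (ruleStepTime B) (update S .vs (encNames (addV H R V))) := by
  have h₁ := runs_copy (ans := ans) (O := O) (x := Var.ru) (y := .ru2) (t := .tmp) (by simp) S
    hS.tmp hRB
  have h₂ := Runs.loop_fold (ans := ans) (O := O) (v := Var.ru2) (p := Option.isSome)
    (c := ruleBody) (T := ruleBodyTime B)
    (st := fun L V => update (update S .ru2 (L.flatMap encRule)) .vs (encNames V))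
    (f := fun V r => if r.1 ∈ H then r.2 :: V else V)
    -- No bound on the vertical states is needed: during this loop `vs` is only pushed on, never
    -- searched.
    (ok := fun L _ => (L.flatMap encRule : List (Sym α)).length ≤ B)
    (by
      intro r L V _
      simp [encRule, encodeItem])
    (by simp)
    (by
      intro r L V hL
      refine (runs_ruleBody _ (H := H) (V := V) (r := r) (w := L.flatMap encRule) (B := B)
        ?_ ?_ ?_ ?_ ?_ ?_ ?_ ?_ ?_ ?_ ?_ ?_ ?_).conv le_rfl ?_
      · simp
      · simpa using hL
      · simpa
      · simpa
      · simp
      all_goals try simp [hS.a, hS.b, hS.c, hS.f, hS.m, hS.neq, hS.tmp, hS.hit]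
      funext v
      cases v <;> simp)
    (by
      intro r L V hL
      simp only [List.flatMap_cons, List.length_append] at hL
      omega) R V (by rwa [← hR])
  have hlen := length_le_length_flatMap (g := (encRule : _ → List (Sym α)))
    (by simp [encRule, encodeItem]) R
  rw [← hR] at hlen
  rw [show update (update S .ru2 (R.flatMap encRule)) .vs (encNames V) =
    update S .ru2 (S .ru ++ S .ru2) by
      funext v
      cases v <;> simp [hR, hV, hS.ru2]] at h₂
  refine (h₁.seq h₂).conv ?_ ?_
  · rw [ruleStepTime]
    gcongr
    omega
  · funext v
    cases v <;> simp [hS.ru2, addV]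

end Universality

end DataTree

/-! ### Horizontal transitions -/

namespace DataTree

open Function StackProg

namespace Universality

variable {α : Type} {P : Set (Pattern α)}

/-- `O` answers whether filters are singleton-valid, in time `Q`. -/
structure IsOracle (P : Set (Pattern α)) (O : List (Sym α) → Bool → ℕ → Prop) (Q : ℕ → ℕ) :
    Prop where
  mono : Monotone Q
  answer (f : Filt P) : ∃ n ≤ Q f.encode.length, O f.encode.reverse (valid f) n

theorem IsOracle.runs_call {O : List (Sym α) → Bool → ℕ → Prop} {Q : ℕ → ℕ} (hO : IsOracle P O Q)
    (f : Filt P) {S : Var → List (Sym α)} {v : Var} (hv : S v = f.encode.reverse) {B : ℕ}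
    (hB : f.encode.length ≤ B) :
    Runs Sym.bit O (.call v) S (Q B) (update S v [Sym.bit (valid f)]) := by
  obtain ⟨n, hn, h⟩ := hO.answer f
  exact (Runs.call (by rwa [hv])).mono (hn.trans (hO.mono hB))

/-- Satisfiability of a filter with a given property, as a Boolean. -/
noncomputable def sat (f : Filt P) (q : ℕ) : Bool := !valid (.not (.and f (.state q)))

theorem sat_eq_true_iff (f : Filt P) (q : ℕ) : sat f q = true ↔ Satisfiable f q := by
  rw [sat, Bool.not_eq_true', valid_not_and]

theorem encodeItem_ne_nil (n : ℕ) : (encodeItem n : List (Sym α)) ≠ [] := by simp [encodeItem]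

/-- The effect of a transition on the list of accessible horizontal states. -/
noncomputable def stepH (V : List ℕ) (H : List ℕ) (t : ℕ × Filt P × ℕ) : List ℕ :=
  if t.1 ∈ H ∧ ∃ q ∈ V, sat t.2.1 q then t.2.2 :: H else H

/-- The effect of all transitions on the list of accessible horizontal states. -/
noncomputable def addH (V : List ℕ) (T : List (ℕ × Filt P × ℕ)) (H : List ℕ) : List ℕ :=
  T.foldl (stepH V) H

theorem length_encNames_stepH (V H : List ℕ) (t : ℕ × Filt P × ℕ) :
    (encNames (stepH V H t) : List (Sym α)).length + 1 ≤
      (encTrans t).length + (encNames H : List (Sym α)).length := by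
  rw [stepH]
  split_ifs <;> simp [encNames, encTrans, encodeItem]; all_goals omega

variable {O : List (Sym α) → Bool → ℕ → Prop} {Q : ℕ → ℕ}

/-- Run a program for all names in the list `x`. -/
def forNames (x x₂ : Var) (c : Prog α) : Prog α :=
  .seq (copy x x₂ .tmp) (.loop x₂ Option.isSome c)

/-- A time bound for `forNames`. -/
def forNamesTime (B T : ℕ) : ℕ := 11 * B + 2 + (B * (T + 1) + 1)

theorem runs_forNames {x x₂ v : Var} (hx : [.tmp, x, x₂].Nodup) (hv : v ≠ x₂) {c : Prog α}
    (S : Var → List (Sym α)) (g : ℕ → Bool) {L : List ℕ} {h : Bool} {B T : ℕ}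
    (hL : S x = encNames L) (hB : (S x).length ≤ B) (hx₂ : S x₂ = []) (htmp : S .tmp = [])
    (hh : S v = flag h)
    (hc : ∀ (n : ℕ) (w : List (Sym α)) (h : Bool), (encodeItem n ++ w).length ≤ B →
      Runs Sym.bit O c (update (update S x₂ (encodeItem n ++ w)) v (flag h)) T
        (update (update S x₂ w) v (flag (h || g n)))) :
    Runs Sym.bit O (forNames x x₂ c) S (forNamesTime B T)
      (update S v (flag (h || decide (∃ n ∈ L, g n)))) := by
  have h₁ := runs_copy (ans := Sym.bit) (O := O) hx S htmp hB
  have h₂ := Runs.loop_fold (ans := Sym.bit) (O := O) (v := x₂) (p := Option.isSome)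
    (c := c) (T := T)
    (st := fun L h => update (update S x₂ (encNames L)) v (flag h))
    (f := fun h n => h || g n)
    (ok := fun L _ => (encNames L : List (Sym α)).length ≤ B)
    (by intro n L h _; simp [encNames_cons, hv.symm])
    (by simp [encNames, hv.symm])
    (fun n L h hL => hc n (encNames L) h hL)
    (by
      intro q L h hL
      simp only [encNames, List.flatMap_cons, List.length_append] at hL ⊢
      omega) L h (by rwa [← hL])
  have hlen := length_le_length_flatMap (encodeItem_ne_nil (α := α)) L
  rw [← encNames, ← hL] at hlen
  have e : update (update S x₂ (encNames L)) v (flag h) = update S x₂ (S x ++ S x₂) := by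
    rw [hL, hx₂, List.append_nil, update_comm hv.symm, ← hh, update_eq_self]
  rw [e] at h₂
  refine (h₁.seq h₂).conv ?_ ?_
  · rw [forNamesTime]
    gcongr
    omega
  · rw [foldl_or, update_comm hv.symm, show encNames [] = S x₂ from hx₂.symm, ← update_of_ne hv.symm
      (flag (h || decide (∃ n ∈ L, g n))) S, update_eq_self]

variable [DecidableEq (Sym α)]

/-- Set the flag `v` if the answer is `b`. -/
def readAnswer (b : Bool) (v : Var) : Prog α :=
  .case .o fun x => .seq (.pop .o) (if x = some (Sym.bit b) then mark v else .skip)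

theorem runs_readAnswer (b : Bool) {v : Var} (hv : v ≠ .o) (S : Var → List (Sym α)) {b' h : Bool}
    (hS : S .o = [Sym.bit b']) (hh : S v = flag h) :
    Runs Sym.bit O (readAnswer b v) S 4 (update (update S .o []) v (flag (h || (b' == b)))) := by
  have h₁ := Runs.pop (ans := Sym.bit) (O := O) Var.o S
  rw [hS] at h₁
  by_cases hb : b' = b
  · refine (Runs.case (v := Var.o) (some (Sym.bit b')) (by rw [hS]; rfl) (h₁.seq (n := 2)
      (S'' := update (update S .o []) v (flag (h || (b' == b)))) ?_)).mono le_rfl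
    rw [if_pos (by rw [hb])]
    exact (runs_mark v _ (h := h) (by simpa [hv])).conv le_rfl (by simp [hb])
  · refine (Runs.case (v := Var.o) (some (Sym.bit b')) (by rw [hS]; rfl) (h₁.seq (n := 1)
      (S'' := update (update S .o []) v (flag (h || (b' == b)))) ?_)).mono (by omega)
    rw [if_neg (by simpa using hb)]
    refine (Runs.skip _).conv le_rfl ?_
    have : flag (h || (b' == b)) = update S .o [] v := by
      simp [beq_eq_false_iff_ne.2 hb, hv, hh]
    rw [this, List.tail_cons, update_eq_self]

/-- Ask whether the filter `f` is satisfied by a pair of a data value and the set of the first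
state in `vs2`. -/
def satQuery : Prog α :=
  .seq (.push .o Sym.not) <| .seq (.push .o Sym.and) <| .seq (copy .f .o .tmp) <|
  .seq (.push .o Sym.state) <| .seq (readUntil Sym.sep .vs2 .o) <| .seq (.call .o) <|
  readAnswer false .hit

/-- A time bound for `satQuery`. -/
def satQueryTime (Q : ℕ → ℕ) (B : ℕ) : ℕ := Q (2 * B + 3) + 16 * B + 11

theorem runs_satQuery (hO : IsOracle P O Q) (S : Var → List (Sym α)) {f : Filt P} {q : ℕ}
    {w : List (Sym α)} {h : Bool} {B : ℕ} (hf : S .f = f.encode.reverse) (hfB : (S .f).length ≤ B)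
    (hq : S .vs2 = encodeItem q ++ w) (hqB : (S .vs2).length ≤ B) (ho : S .o = [])
    (htmp : S .tmp = []) (hh : S .hit = flag h) :
    Runs Sym.bit O satQuery S (satQueryTime Q B)
      (update (update S .vs2 w) .hit (flag (h || sat f q))) := by
  rw [hf] at hfB
  simp only [hq, encodeItem, List.length_append, List.length_singleton] at hqB
  simp only [List.length_reverse] at hfB
  refine ((Runs.push .o Sym.not S).seq ((Runs.push .o Sym.and _).seq
    ((runs_copy (x := .f) (y := .o) (t := .tmp) (by simp) _ (by simpa) (B := B)
      (by simpa [hf])).seq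
    ((Runs.push .o Sym.state _).seq
    ((runs_readUntil (x := .vs2) (y := .o) (by simp) _ (w := encodeName q) (r := w)
      (by simp [hq, encodeItem]) (sep_notMem_encodeName q) (B := B) (by omega)).seq
    -- Three operator symbols, the filter and the name make up the query. It lies reversed on `o`,
    -- and the call reverses it again.
    ((hO.runs_call (.not (.and f (.state q))) (v := .o) (B := 2 * B + 3) ?_ ?_).seq
    (runs_readAnswer false (v := .hit) (by simp) _
      (b' := valid (.not (.and f (.state q)))) (h := h) ?_ ?_))))))).conv ?_ ?_
  · simp [hf, ho, Filt.encode]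
  · simp [Filt.encode]; omega
  · simp
  · simp [hh]
  · rw [satQueryTime]; omega
  · funext v
    cases v <;> simp [ho, sat]

/-- Ask whether the filter `f` is satisfied by a pair of a data value and the set of some
state in `vs`. -/
def satQueries : Prog α := forNames .vs .vs2 satQuery

/-- A time bound for `satQueries`. -/
def satQueriesTime (Q : ℕ → ℕ) (B : ℕ) : ℕ := forNamesTime B (satQueryTime Q B)

theorem runs_satQueries (hO : IsOracle P O Q) (S : Var → List (Sym α)) {f : Filt P} {V : List ℕ}
    {B : ℕ} (hf : S .f = f.encode.reverse) (hfB : (S .f).length ≤ B)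
    (hV : S .vs = encNames V) (hVB : (S .vs).length ≤ B) (hvs2 : S .vs2 = []) (ho : S .o = [])
    (htmp : S .tmp = []) (hh : S .hit = []) :
    Runs Sym.bit O satQueries S (satQueriesTime Q B)
      (update S .hit (flag (decide (∃ q ∈ V, sat f q)))) := by
  refine (runs_forNames (by simp) (v := .hit) (by simp) S (fun q => sat f q) (h := false) hV hVB
    hvs2 htmp hh ?_).conv le_rfl (by simp)
  intro q w h hB
  refine (runs_satQuery hO _ (f := f) (q := q) (w := w) (h := h) (B := B)
    (by simpa) (by simpa) (by simp) (by simpa using hB) (by simpa) (by simpa)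
    (by simp)).conv le_rfl ?_
  funext v
  cases v <;> simp

/-- Apply a horizontal transition. -/
def transBody : Prog α :=
  .seq (readUntil Sym.sep .tr2 .a) <| .seq (readUntil Sym.sep .tr2 .f) <|
  .seq (readUntil Sym.sep .tr2 .e) <| .seq (lookup .hs .skip) <|
  .seq (branch .hit satQueries .skip) <|
  .seq (branch .hit (.seq (.push .hs Sym.sep) (move .e .hs)) (clear .e)) <|
  .seq (clear .a) (clear .f)

/-- A time bound for `transBody`. -/
def transBodyTime (Q : ℕ → ℕ) (B : ℕ) : ℕ := lookupTime B + satQueriesTime Q B + 30 * B + 20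

theorem runs_transBody (hO : IsOracle P O Q) {S : Var → List (Sym α)} (hS : ∀ x ∈
      [Var.a, .b, .c, .e, .f, .m, .o, .tmp, .hit, .neq, .vs2], S x = [])
    {H V : List ℕ} {t : ℕ × Filt P × ℕ} {w : List (Sym α)}
    {B : ℕ} (ht : S .tr2 = encTrans t ++ w) (htB : (S .tr2).length ≤ B) (hH : S .hs = encNames H)
    (hHB : (S .hs).length ≤ B) (hV : S .vs = encNames V) (hVB : (S .vs).length ≤ B) :
    Runs Sym.bit O transBody S (transBodyTime Q B) (update (update S .tr2 w) .hs
      (encNames (stepH V H t))) := by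
  simp only [List.forall_mem_cons, List.not_mem_nil, false_imp_iff, implies_true, and_true] at hS
  obtain ⟨ha, hb, hc, he, hf, hm, ho, htmp, hhit, hneq, hvs2⟩ := hS
  have hlen := htB
  simp only [ht, encTrans, encodeItem, List.length_append, List.length_singleton] at hlen
  have h₁ : ∀ S' : Var → List (Sym α), S' .hit = flag (decide (t.1 ∈ H)) →
      S' .f = t.2.1.encode.reverse → S' .vs = encNames V → S' .vs2 = [] → S' .o = [] →
      S' .tmp = [] → Runs Sym.bit O (branch .hit satQueries .skip) S' (satQueriesTime Q B + 3)
        (update S' .hit (flag (decide (t.1 ∈ H ∧ ∃ q ∈ V, sat t.2.1 q)))) := by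
    intro S' hh hf' hv hv2 ho' ht'
    by_cases h : t.1 ∈ H
    · refine (runs_branch_true (v := .hit) (S := S') (by simp [hh, h]) (runs_satQueries hO _
        (f := t.2.1) (V := V) (B := B) (by simpa) ?_ (by simpa) ?_ (by simpa) (by simpa) (by simpa)
        (by simp))).conv ?_ ?_
      · simp [hf']; omega
      · simpa [hv, ← hV]
      · omega
      · funext v
        cases v <;> simp [h]
    · refine (runs_branch_false (v := .hit) (S := S') (by simp [hh, h]) (Runs.skip S')).conv ?_ ?_
      · omega
      · funext v
        cases v <;> simp [h, hh]
  have h₂ : ∀ S' : Var → List (Sym α),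
      S' .hit = flag (decide (t.1 ∈ H ∧ ∃ q ∈ V, sat t.2.1 q)) →
      S' .e = (encodeName t.2.2).reverse → S' .hs = encNames H →
      Runs Sym.bit O (branch .hit (.seq (.push .hs Sym.sep) (move .e .hs)) (clear .e)) S' (5 * B + 4)
        (update (update (update S' .hit []) .e []) .hs
          (encNames (stepH V H t))) := by
    intro S' hh he' hv
    by_cases h : t.1 ∈ H ∧ ∃ q ∈ V, sat t.2.1 q
    · rw [decide_eq_true h] at hh
      refine (runs_branch_true (v := .hit) (S := S') (by simp [hh]) ((Runs.push .hs Sym.sep _).seq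
        (runs_move (x := .e) (y := .hs) (by simp) _ (B := B) ?_))).conv ?_ ?_
      · simp [he']; omega
      · omega
      · rw [stepH, if_pos h]
        funext v
        cases v <;> simp [he', hv, encNames_cons]
    · rw [decide_eq_false h] at hh
      refine (runs_branch_false (v := .hit) (S := S') (by simp [hh])
        (runs_clear .e _ (B := B) ?_)).conv ?_ ?_
      · simp [he']; omega
      · omega
      · rw [stepH, if_neg h]
        funext v
        cases v <;> simp [hh, hv]
  refine ((runs_readUntil (x := Var.tr2) (y := Var.a) (by simp) S (w := encodeName t.1)
    (r := t.2.1.encode ++ [Sym.sep] ++ encodeItem t.2.2 ++ w) (by simp [ht, encTrans, encodeItem])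
    (sep_notMem_encodeName _) (B := B) (by omega)).seq
    ((runs_readUntil (x := Var.tr2) (y := Var.f) (by simp) _ (w := t.2.1.encode)
    (r := encodeItem t.2.2 ++ w) (by simp) (notMem_encode_filt _).1 (B := B) (by omega)).seq
    ((runs_readUntil (x := Var.tr2) (y := Var.e) (by simp) _ (w := encodeName t.2.2)
    (r := w) (by simp [encodeItem]) (sep_notMem_encodeName _) (B := B) (by omega)).seq
    ((runs_lookup_names H .hs (by simp) (B := B) (n := t.1) _ (by simpa) (by simpa) (by simp [ha])
      (by omega) (by simpa) (by simpa) (by simpa) (by simpa) (by simpa) (by simpa)).seq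
    ((h₁ _ (by simp) (by simp [hf]) (by simpa) (by simpa) (by simpa) (by simpa)).seq
    ((h₂ _ (by simp) (by simp [he]) (by simpa)).seq
    ((runs_clear .a _ (B := B) ?_).seq (runs_clear .f _ (B := B) ?_)))))))).conv ?_ ?_
  · simp [ha]; omega
  · simp [hf]; omega
  · rw [transBodyTime]; omega
  · funext v
    cases v <;> simp [ha, hf, he, hhit]

/-- Apply all horizontal transitions. -/
def transStep : Prog α :=
  .seq (copy .tr .tr2 .tmp) (.loop .tr2 Option.isSome transBody)

/-- A time bound for `transStep`. -/
def transStepTime (Q : ℕ → ℕ) (B : ℕ) : ℕ := 11 * B + 2 + (B * (transBodyTime Q B + 1) + 1)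

theorem runs_transStep (hO : IsOracle P O Q) {S : Var → List (Sym α)} (hS : Clean S)
    {H V : List ℕ} {T : List (ℕ × Filt P × ℕ)} {B : ℕ} (hT : S .tr = T.flatMap encTrans)
    (hH : S .hs = encNames H) (hHB : (S .tr).length + (S .hs).length ≤ B)
    (hV : S .vs = encNames V) (hVB : (S .vs).length ≤ B) :
    Runs Sym.bit O transStep S (transStepTime Q B) (update S .hs (encNames (addH V T H))) := by
  have h₁ := runs_copy (ans := Sym.bit) (O := O) (x := Var.tr) (y := .tr2) (t := .tmp) (by simp) S
    hS.tmp (B := B) (by omega)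
  have h₂ := Runs.loop_fold (ans := Sym.bit) (O := O) (v := Var.tr2) (p := Option.isSome)
    (c := transBody) (T := transBodyTime Q B)
    (st := fun L H => update (update S .tr2 (L.flatMap encTrans)) .hs (encNames H))
    (f := stepH V)
    -- Here `hs` is searched while it grows. The sum is bounded throughout because a transition
    -- removed from `tr2` pays for the name that it adds to `hs`.
    (ok := fun L H => (L.flatMap encTrans : List (Sym α)).length +
      (encNames H : List (Sym α)).length ≤ B)
    (by
      intro t L H _
      simp [encTrans, encodeItem])
    (by simp)
    (by
      intro t L H hL
      refine (runs_transBody hO (H := H) (V := V) (t := t) (w := L.flatMap encTrans) (B := B)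
        ?_ ?_ ?_ ?_ ?_ ?_ ?_).conv le_rfl ?_
      · simp [hS.a, hS.b, hS.c, hS.e, hS.f, hS.m, hS.o, hS.neq, hS.tmp, hS.hit, hS.vs2]
      · simp
      · simp at hL ⊢; omega
      · simp
      · simp; omega
      · simpa
      · simpa
      · funext v
        cases v <;> simp)
    (by
      intro t L H hL
      simp only [List.flatMap_cons, List.length_append] at hL
      have := length_encNames_stepH V H t
      omega) T H (by rwa [← hT, ← hH])
  have hlen := length_le_length_flatMap (g := (encTrans : _ × Filt P × _ → List (Sym α)))
    (by simp [encTrans, encodeItem]) T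
  rw [← hT] at hlen
  rw [show update (update S .tr2 (T.flatMap encTrans)) .hs (encNames H) =
    update S .tr2 (S .tr ++ S .tr2) by
      funext v
      cases v <;> simp [hT, hH, hS.tr2]] at h₂
  refine (h₁.seq h₂).conv ?_ ?_
  · rw [transStepTime]
    gcongr
    omega
  · funext v
    cases v <;> simp [hS.tr2, addH]

end Universality

end DataTree

/-! ### Saturation and checks -/

namespace DataTree

open Function StackProg

namespace Universality

variable {α : Type} {P : Set (Pattern α)} {O : List (Sym α) → Bool → ℕ → Prop} {Q : ℕ → ℕ}

/-- One round of saturation. -/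
noncomputable def round (R : List (ℕ × ℕ)) (T : List (ℕ × Filt P × ℕ)) (x : List ℕ × List ℕ) :
    List ℕ × List ℕ :=
  (addH (addV x.1 R x.2) T x.1, addV x.1 R x.2)

/-- Each rule adds its target at most once per round, and the target's name is part of the encoding
of the rule. -/
theorem length_encNames_addV (H : List ℕ) (R : List (ℕ × ℕ)) : ∀ V : List ℕ,
    (encNames (addV H R V) : List (Sym α)).length ≤
      (R.flatMap encRule : List (Sym α)).length + (encNames V : List (Sym α)).length := by
  induction R with
  | nil => intro V; simp [addV]
  | cons r R ih =>
    intro V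
    have := ih (if r.1 ∈ H then r.2 :: V else V)
    rw [addV, List.foldl_cons]
    refine this.trans ?_
    split_ifs
    · simp [encNames, encRule, encodeItem]; omega
    · simp [encNames]

theorem length_encNames_addH (V : List ℕ) (T : List (ℕ × Filt P × ℕ)) : ∀ H : List ℕ,
    (encNames (addH V T H) : List (Sym α)).length ≤
      (T.flatMap encTrans : List (Sym α)).length + (encNames H : List (Sym α)).length := by
  induction T with
  | nil => intro H; simp [addH]
  | cons t T ih =>
    intro H
    have := ih (stepH V H t)
    have := length_encNames_stepH V H t
    rw [addH, List.foldl_cons]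
    rw [addH] at *
    simp only [List.flatMap_cons, List.length_append]
    omega

/-- The contribution of filters to a query. -/
def encAvoid (fs : List (Filt P)) : List (Sym α) :=
  fs.flatMap fun f => Sym.and :: Sym.not :: f.encode

/-- The filters of the transitions from the state `p`. -/
def outFilters (T : List (ℕ × Filt P × ℕ)) (p : ℕ) : List (Filt P) :=
  T.flatMap fun t => if t.1 = p then [t.2.1] else []

/-- The two operators in front of a filter are paid for by the separators in the encoding of its
transition. -/
theorem length_encAvoid_le (T : List (ℕ × Filt P × ℕ)) (p : ℕ) :
    (encAvoid (outFilters T p)).length ≤ (T.flatMap encTrans).length := by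
  induction T with
  | nil => simp [outFilters, encAvoid]
  | cons t T ih =>
    have : encAvoid (outFilters (t :: T) p) =
        encAvoid (if t.1 = p then [t.2.1] else []) ++ encAvoid (outFilters T p) := by
      simp [outFilters, encAvoid]
    rw [this]
    split_ifs
    · simp [encAvoid, encTrans, encodeItem] at ih ⊢; omega
    · simp [encAvoid] at ih ⊢; omega

theorem runs_branch_mark {S : Var → List (Sym α)} {b h : Bool} (hh : S .hit = flag b)
    (hb : S .bad = flag h) :
    Runs Sym.bit O (branch .hit .skip (mark .bad)) S 4
      (update (update S .hit []) .bad (flag (h || !b))) := by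
  cases b
  · refine (runs_branch_false hh (runs_mark .bad S hb)).conv le_rfl ?_
    funext v
    cases v <;> simp [hh]
  · refine (runs_branch_true hh (Runs.skip _)).conv (by omega) ?_
    funext v
    cases v <;> simp [hb]

variable [DecidableEq (Sym α)]

/-- Apply the vertical rules and the horizontal transitions as often as `cnt` tells. -/
def saturate : Prog α :=
  .loop .cnt Option.isSome (.seq (.pop .cnt) (.seq ruleStep transStep))

/-- A time bound for `saturate`. -/
def saturateTime (Q : ℕ → ℕ) (N B : ℕ) : ℕ := N * (1 + (ruleStepTime B + transStepTime Q B) + 1) + 1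

theorem runs_saturate (hO : IsOracle P O Q) {S : Var → List (Sym α)} (hS : Clean S)
    {H V : List ℕ} {R : List (ℕ × ℕ)} {T : List (ℕ × Filt P × ℕ)} {N B : ℕ}
    (hR : S .ru = R.flatMap encRule) (hT : S .tr = T.flatMap encTrans)
    (hH : S .hs = encNames H) (hV : S .vs = encNames V) (hN : (S .cnt).length = N)
    (hRN : (S .ru).length ≤ N) (hTN : (S .tr).length ≤ N)
    (hHB : (S .hs).length + N * N + N ≤ B) (hVB : (S .vs).length + N * N + N ≤ B) :
    Runs Sym.bit O saturate S (saturateTime Q N B)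
      (update (update (update S .cnt []) .hs (encNames ((round R T)^[N] (H, V)).1)) .vs
        (encNames ((round R T)^[N] (H, V)).2)) := by
  have h := Runs.loop_fold (ans := Sym.bit) (O := O) (v := Var.cnt) (p := Option.isSome)
    (c := .seq (.pop .cnt) (.seq ruleStep transStep))
    (T := 1 + (ruleStepTime B + transStepTime Q B))
    (st := fun (L : List (Sym α)) x =>
      update (update (update S .cnt L) .hs (encNames x.1)) .vs (encNames x.2))
    (f := fun x _ => round R T x)
    -- Each remaining round may add `N` symbols to either list; the last `N` leaves room for the
    -- transitions within a round.
    (ok := fun L x => (encNames x.1 : List (Sym α)).length + L.length * N + N ≤ B ∧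
      (encNames x.2 : List (Sym α)).length + L.length * N + N ≤ B)
    (by intro t L x _; simp)
    (by simp)
    (by
      rintro t L x ⟨h₁, h₂⟩
      rw [List.length_cons, Nat.add_mul] at h₁ h₂
      have hl := length_encNames_addV (α := α) x.1 R x.2
      rw [← hR] at hl
      refine ((Runs.pop _ _).seq ((runs_ruleStep (H := x.1) (V := x.2) (R := R) (B := B)
        ?_ ?_ ?_ ?_ ?_ ?_).seq (runs_transStep hO (H := x.1) (V := addV x.1 R x.2) (T := T)
        (B := B) ?_ ?_ ?_ ?_ ?_ ?_))).conv le_rfl ?_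
      · constructor <;> simp [hS.a, hS.b, hS.c, hS.e, hS.f, hS.m, hS.o, hS.tmp, hS.hit, hS.neq,
          hS.tr2, hS.ru2, hS.hs2, hS.vs2]
      · simpa
      · simp; omega
      · simp
      · simp; omega
      · simp
      · constructor <;> simp [hS.a, hS.b, hS.c, hS.e, hS.f, hS.m, hS.o, hS.tmp, hS.hit, hS.neq,
          hS.tr2, hS.ru2, hS.hs2, hS.vs2]
      · simpa
      · simp
      · simp; omega
      · simp
      · simp; omega
      · funext v
        cases v <;> simp [round])
    (by
      rintro t L x ⟨h₁, h₂⟩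
      rw [List.length_cons, Nat.add_mul] at h₁ h₂
      have hl := length_encNames_addV (α := α) x.1 R x.2
      have hl' := length_encNames_addH (addV x.1 R x.2) T x.1
      rw [← hR] at hl
      rw [← hT] at hl'
      constructor <;> simp only [round] <;> omega)
    (S .cnt) (H, V) (by rw [← hH, ← hV, hN]; exact ⟨hHB, hVB⟩)
  rw [show update (update (update S .cnt (S .cnt)) .hs (encNames (H, V).1)) .vs
    (encNames (H, V).2) = S by rw [update_eq_self, ← hH, update_eq_self, ← hV, update_eq_self]] at h
  refine h.conv ?_ ?_
  · rw [hN, saturateTime]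
  · rw [List.foldl_const, hN]

/-- Check that the states in `vs` are final. -/
def checkFinal : Prog α :=
  forNames .vs .vs2 <| .seq (readUntil Sym.sep .vs2 .a) <| .seq (lookup .fin .skip) <|
    .seq (branch .hit .skip (mark .bad)) (clear .a)

/-- A time bound for `checkFinal`. -/
def checkFinalTime (B : ℕ) : ℕ := forNamesTime B (lookupTime B + 9 * B + 10)

theorem runs_checkFinal {S : Var → List (Sym α)} (hS : Clean S) {F V : List ℕ} {h : Bool} {B : ℕ}
    (hF : S .fin = encNames F) (hFB : (S .fin).length ≤ B) (hV : S .vs = encNames V)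
    (hVB : (S .vs).length ≤ B) (hb : S .bad = flag h) :
    Runs Sym.bit O checkFinal S (checkFinalTime B)
      (update S .bad (flag (h || decide (∃ q ∈ V, q ∉ F)))) := by
  refine (runs_forNames (by simp) (v := .bad) (by simp) S (fun q => decide (q ∉ F)) hV hVB
    hS.vs2 hS.tmp hb ?_).conv le_rfl (by simp)
  intro q w h hB
  simp only [encodeItem, List.length_append, List.length_singleton] at hB
  refine ((runs_readUntil (x := .vs2) (y := .a) (by simp)
    (update (update S .vs2 (encodeItem q ++ w)) .bad (flag h)) (w := encodeName q) (r := w)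
    (by simp [encodeItem]) (sep_notMem_encodeName q) (B := B) (by omega)).seq
    ((runs_lookup_names F .fin (by simp) (B := B) (n := q) _ (by simpa) (by simpa)
      (by simp [hS.a]) (by omega) (by simp [hS.m]) (by simp [hS.b]) (by simp [hS.c])
      (by simp [hS.neq]) (by simp [hS.tmp]) (by simp [hS.hit])).seq
    ((runs_branch_mark (b := decide (q ∈ F)) (h := h) (by simp) (by simp)).seq
      (runs_clear .a _ (B := B) ?_)))).conv ?_ ?_
  · simp [hS.a]; omega
  · omega
  · funext v
    cases v <;> simp [hS.a, hS.hit]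

/-- If the next transition starts in the state `a`, then its filter is added to the query. -/
def collectBody : Prog α :=
  .seq (readUntil Sym.sep .tr2 .b) <| .seq (readUntil Sym.sep .tr2 .f) <|
  .seq (dropUntil Sym.sep .tr2) <| .seq compare <|
  .seq (branch .hit (.seq (.push .o Sym.and) (.seq (.push .o Sym.not) (copy .f .o .tmp))) .skip) <|
  clear .f

/-- A time bound for `collectBody`. -/
def collectBodyTime (B : ℕ) : ℕ := compareTime B + 40 * B + 20

theorem runs_collectBody {S : Var → List (Sym α)} (hS : ∀ x ∈
      [Var.b, .c, .f, .tmp, .hit, .neq], S x = [])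
    {p : ℕ} {t : ℕ × Filt P × ℕ} {u w : List (Sym α)} {B : ℕ}
    (hp : S .a = (encodeName p).reverse) (hpB : (S .a).length ≤ B)
    (ht : S .tr2 = encTrans t ++ w) (htB : (S .tr2).length ≤ B) (ho : S .o = u.reverse) :
    Runs Sym.bit O collectBody S (collectBodyTime B) (update (update S .tr2 w) .o
      (u ++ encAvoid (if t.1 = p then [t.2.1] else [])).reverse) := by
  simp only [List.forall_mem_cons, List.not_mem_nil, false_imp_iff, implies_true, and_true] at hS
  obtain ⟨hb, hc, hf, htmp, hhit, hneq⟩ := hS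
  have hlen := htB
  simp only [ht, encTrans, encodeItem, List.length_append, List.length_singleton] at hlen
  have h₁ : ∀ S' : Var → List (Sym α), S' .hit = flag (decide (t.1 = p)) →
      S' .f = t.2.1.encode.reverse → S' .o = u.reverse → S' .tmp = [] →
      Runs Sym.bit O (branch .hit
        (.seq (.push .o Sym.and) (.seq (.push .o Sym.not) (copy .f .o .tmp))) .skip) S' (11 * B + 6)
        (update (update S' .hit []) .o
          (u ++ encAvoid (if t.1 = p then [t.2.1] else [])).reverse) := by
    intro S' hh hf' ho' ht'
    by_cases h : t.1 = p
    · refine (runs_branch_true (v := .hit) (S := S') (by simp [hh, h]) ((Runs.push .o Sym.and _).seq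
        ((Runs.push .o Sym.not _).seq (runs_copy (x := .f) (y := .o) (t := .tmp) (by simp) _
          (by simpa) (B := B) ?_)))).conv ?_ ?_
      · simp [hf']; omega
      · omega
      · funext v
        cases v <;> simp [h, hf', ho', encAvoid]
    · refine (runs_branch_false (v := .hit) (S := S') (by simp [hh, h]) (Runs.skip S')).conv ?_ ?_
      · omega
      · funext v
        cases v <;> simp [h, hh, ho', encAvoid]
  refine ((runs_readUntil (x := Var.tr2) (y := Var.b) (by simp) S (w := encodeName t.1)
    (r := t.2.1.encode ++ [Sym.sep] ++ encodeItem t.2.2 ++ w) (by simp [ht, encTrans, encodeItem])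
    (sep_notMem_encodeName _) (B := B) (by omega)).seq
    ((runs_readUntil (x := Var.tr2) (y := Var.f) (by simp) _ (w := t.2.1.encode)
    (r := encodeItem t.2.2 ++ w) (by simp) (notMem_encode_filt _).1 (B := B) (by omega)).seq
    ((runs_dropUntil (x := Var.tr2) _ (w := encodeName t.2.2)
    (r := w) (by simp [encodeItem]) (sep_notMem_encodeName _) (B := B) (by omega)).seq
    ((runs_compare (h := false) (B := B) _ (by simpa) ?_ (by simpa) (by simpa) (by simpa)
      (by simpa)).seq
    ((h₁ _ ?_ (by simp [hf]) (by simpa) (by simpa)).seq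
    (runs_clear .f _ (B := B) ?_)))))).conv ?_ ?_
  · simp [hb]; omega
  · simp [hb, hp, encodeName_injective.eq_iff, eq_comm]
  · simp [hf]; omega
  · rw [collectBodyTime]; omega
  · funext v
    cases v <;> simp [hb, hf, hhit]

/-- Add the filters of the transitions from the state `a` to the query. -/
def collect : Prog α := .seq (copy .tr .tr2 .tmp) (.loop .tr2 Option.isSome collectBody)

/-- A time bound for `collect`. -/
def collectTime (B : ℕ) : ℕ := 11 * B + 2 + (B * (collectBodyTime B + 1) + 1)

theorem runs_collect {S : Var → List (Sym α)} (hS : ∀ x ∈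
      [Var.b, .c, .f, .tmp, .hit, .neq, .tr2], S x = [])
    {p : ℕ} {T : List (ℕ × Filt P × ℕ)} {u : List (Sym α)} {B : ℕ}
    (hp : S .a = (encodeName p).reverse) (hpB : (S .a).length ≤ B)
    (hT : S .tr = T.flatMap encTrans) (hTB : (S .tr).length ≤ B) (ho : S .o = u.reverse) :
    Runs Sym.bit O collect S (collectTime B)
      (update S .o (u ++ encAvoid (outFilters T p)).reverse) := by
  simp only [List.forall_mem_cons, List.not_mem_nil, false_imp_iff, implies_true, and_true] at hS
  obtain ⟨hb, hc, hf, htmp, hhit, hneq, htr2⟩ := hS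
  have h₁ := runs_copy (ans := Sym.bit) (O := O) (x := Var.tr) (y := .tr2) (t := .tmp) (by simp) S
    htmp (B := B) (by omega)
  have h₂ := Runs.loop_fold (ans := Sym.bit) (O := O) (v := Var.tr2) (p := Option.isSome)
    (c := collectBody) (T := collectBodyTime B)
    (st := fun L u => update (update S .tr2 (L.flatMap encTrans)) .o u.reverse)
    (f := fun u t => u ++ encAvoid (if t.1 = p then [t.2.1] else []))
    (ok := fun L _ => (L.flatMap encTrans : List (Sym α)).length ≤ B)
    (by
      intro t L u _
      simp [encTrans, encodeItem])
    (by simp)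
    (by
      intro t L u hL
      refine (runs_collectBody (p := p) (t := t) (u := u) (w := L.flatMap encTrans) (B := B)
        ?_ ?_ ?_ ?_ ?_ ?_).conv le_rfl ?_
      · simp [hb, hc, hf, htmp, hhit, hneq]
      · simpa
      · simpa
      · simp
      · simpa using hL
      · simp
      · funext v
        cases v <;> simp)
    (by
      intro t L H hL
      simp only [List.flatMap_cons, List.length_append] at hL
      omega) T u (by rwa [← hT])
  have hlen := length_le_length_flatMap (g := (encTrans : _ × Filt P × _ → List (Sym α)))
    (by simp [encTrans, encodeItem]) T
  rw [← hT] at hlen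
  rw [show update (update S .tr2 (T.flatMap encTrans)) .o u.reverse =
    update S .tr2 (S .tr ++ S .tr2) by
      funext v
      cases v <;> simp [hT, ho, htr2]] at h₂
  have hfold : ∀ (T : List (ℕ × Filt P × ℕ)) (u : List (Sym α)),
      T.foldl (fun u t => u ++ encAvoid (if t.1 = p then [t.2.1] else [])) u =
        u ++ encAvoid (outFilters T p) := by
    intro T
    induction T with
    | nil => simp [outFilters, encAvoid]
    | cons t T ih =>
      intro u
      rw [List.foldl_cons, ih]
      simp [outFilters, encAvoid]
  refine (h₁.seq h₂).conv ?_ ?_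
  · rw [collectTime]
    gcongr
    omega
  · rw [hfold]
    funext v
    cases v <;> simp [htr2]

/-- Check that the state `a` can read all data values together with the first state of `vs2`. -/
def readBody : Prog α :=
  .seq (.push .o Sym.not) <| .seq collect <| .seq (.push .o Sym.state) <|
  .seq (readUntil Sym.sep .vs2 .o) <| .seq (.call .o) <| readAnswer false .bad

/-- A time bound for `readBody`. -/
def readBodyTime (Q : ℕ → ℕ) (B : ℕ) : ℕ := Q (2 * B + 3) + collectTime B + 5 * B + 10

/-- Check that the state `a` can read everything. -/
def checkRead : Prog α := forNames .vs .vs2 readBody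

/-- A time bound for `checkRead`. -/
def checkReadTime (Q : ℕ → ℕ) (B : ℕ) : ℕ := forNamesTime B (readBodyTime Q B)

/-- The state `p` can read everything together with `q`. -/
noncomputable def readsAll (T : List (ℕ × Filt P × ℕ)) (p q : ℕ) : Bool :=
  valid (.not (avoid (outFilters T p) q))

/-- The query is built on `o` from its first symbol upwards. A negative answer means that some data
value cannot be read together with `q`, and then `bad` is marked. -/
theorem runs_checkRead (hO : IsOracle P O Q) {S : Var → List (Sym α)} (hS : ∀ x ∈
      [Var.b, .c, .f, .o, .tmp, .hit, .neq, .tr2, .vs2], S x = [])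
    {p : ℕ} {T : List (ℕ × Filt P × ℕ)} {V : List ℕ} {h : Bool} {B : ℕ}
    (hp : S .a = (encodeName p).reverse) (hpB : (S .a).length ≤ B)
    (hT : S .tr = T.flatMap encTrans) (hTB : (S .tr).length ≤ B) (hV : S .vs = encNames V)
    (hVB : (S .vs).length ≤ B) (hbad : S .bad = flag h) :
    Runs Sym.bit O checkRead S (checkReadTime Q B)
      (update S .bad (flag (h || decide (∃ q ∈ V, readsAll T p q = false)))) := by
  simp only [List.forall_mem_cons, List.not_mem_nil, false_imp_iff, implies_true, and_true] at hS
  obtain ⟨hb, hc, hf, ho, htmp, hhit, hneq, htr2, hvs2⟩ := hS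
  refine (runs_forNames (by simp) (v := .bad) (by simp) S (fun q => !readsAll T p q) hV hVB
    hvs2 htmp hbad ?_).conv le_rfl (by simp)
  intro q w h hB
  simp only [encodeItem, List.length_append, List.length_singleton] at hB
  have hl := length_encAvoid_le T p
  rw [← hT] at hl
  refine ((Runs.push .o Sym.not _).seq
    ((runs_collect (p := p) (T := T) (u := [Sym.not]) (B := B) ?_ (by simpa) (by simpa)
      (by simpa) (by simpa) (by simp [ho])).seq
    ((Runs.push .o Sym.state _).seq
    ((runs_readUntil (x := .vs2) (y := .o) (by simp) _ (w := encodeName q) (r := w)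
      (by simp [encodeItem]) (sep_notMem_encodeName q) (B := B) (by omega)).seq
    ((hO.runs_call (.not (avoid (outFilters T p) q)) (v := .o) (B := 2 * B + 3) ?_ ?_).seq
    (runs_readAnswer false (v := .bad) (by simp) _ (b' := readsAll T p q) (h := h) ?_ ?_)))))).conv
      ?_ ?_
  · simp [hb, hc, hf, htmp, hhit, hneq, htr2]
  · simp [Filt.encode, encode_avoid, encAvoid]
  · rw [Filt.encode, encode_avoid, ← encAvoid]
    simp
    omega
  · simp [readsAll]
  · simp
  · rw [readBodyTime]; omega
  · funext v
    cases v <;> simp [ho]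

/-- Check the conditions on the horizontal states. -/
def checkHor : Prog α :=
  forNames .hs .hs2 <| .seq (readUntil Sym.sep .hs2 .a) <|
    .seq (lookup .ru (dropUntil Sym.sep .m)) <| .seq (branch .hit .skip (mark .bad)) <|
    .seq checkRead (clear .a)

/-- A time bound for `checkHor`. -/
def checkHorTime (Q : ℕ → ℕ) (B : ℕ) : ℕ :=
  forNamesTime B (lookupTime B + checkReadTime Q B + 9 * B + 10)

theorem runs_checkHor (hO : IsOracle P O Q) {S : Var → List (Sym α)} (hS : Clean S)
    {R : List (ℕ × ℕ)} {T : List (ℕ × Filt P × ℕ)} {H V : List ℕ} {h : Bool} {B : ℕ}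
    (hR : S .ru = R.flatMap encRule) (hRB : (S .ru).length ≤ B)
    (hT : S .tr = T.flatMap encTrans) (hTB : (S .tr).length ≤ B)
    (hH : S .hs = encNames H) (hHB : (S .hs).length ≤ B)
    (hV : S .vs = encNames V) (hVB : (S .vs).length ≤ B) (hb : S .bad = flag h) :
    Runs Sym.bit O checkHor S (checkHorTime Q B)
      (update S .bad (flag (h || decide (∃ p ∈ H, ¬ (∃ r ∈ R, r.1 = p) ∨
        ∃ q ∈ V, readsAll T p q = false)))) := by
  refine (runs_forNames (by simp) (v := .bad) (by simp) S (fun p =>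
    decide (¬ (∃ r ∈ R, r.1 = p) ∨ ∃ q ∈ V, readsAll T p q = false)) hH hHB
    hS.hs2 hS.tmp hb ?_).conv le_rfl (by simp only [decide_eq_true_eq])
  intro p w h hB
  simp only [encodeItem, List.length_append, List.length_singleton] at hB
  refine ((runs_readUntil (x := .hs2) (y := .a) (by simp)
    (update (update S .hs2 (encodeItem p ++ w)) .bad (flag h)) (w := encodeName p) (r := w)
    (by simp [encodeItem]) (sep_notMem_encodeName p) (B := B) (by omega)).seq
    ((runs_lookup_rules R .ru (by simp) (B := B) (n := p) _ (by simpa) (by simpa)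
      (by simp [hS.a]) (by omega) (by simp [hS.m]) (by simp [hS.b]) (by simp [hS.c])
      (by simp [hS.neq]) (by simp [hS.tmp]) (by simp [hS.hit])).seq
    ((runs_branch_mark (b := decide (∃ r ∈ R, r.1 = p)) (h := h) (by simp) (by simp)).seq
    ((runs_checkRead hO (p := p) (T := T) (V := V) (h := h || !decide (∃ r ∈ R, r.1 = p)) (B := B)
      ?_ (by simp [hS.a]) ?_ (by simpa) (by simpa) (by simpa) (by simpa) (by simp)).seq
    (runs_clear .a _ (B := B) ?_))))).conv ?_ ?_
  · simp [hS.b, hS.c, hS.f, hS.o, hS.tmp, hS.neq, hS.tr2, hS.vs2]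
  · simp [hS.a]; omega
  · simp [hS.a]; omega
  · omega
  · have hd : (h || !decide (∃ r ∈ R, r.1 = p) || decide (∃ q ∈ V, readsAll T p q = false)) =
        (h || decide (¬ (∃ r ∈ R, r.1 = p) ∨ ∃ q ∈ V, readsAll T p q = false)) := by
      rw [Bool.decide_or, decide_not, Bool.or_assoc]
    rw [hd]
    funext v
    cases v <;> simp [hS.a, hS.hit]

end Universality

end DataTree

/-! ### Correctness of saturation -/

namespace DataTree

namespace Universality

variable {α : Type} {P : Set (Pattern α)} {R : List (ℕ × ℕ)} {T : List (ℕ × Filt P × ℕ)}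

/-- Sets of horizontal and vertical states that are closed under the rules and transitions. -/
structure Closed (R : List (ℕ × ℕ)) (T : List (ℕ × Filt P × ℕ)) (GH GV : ℕ → Prop) : Prop where
  rule : ∀ r ∈ R, GH r.1 → GV r.2
  trans : ∀ t ∈ T, GH t.1 → ∀ q, GV q → sat t.2.1 q → GH t.2.2

theorem mem_addV {H : List ℕ} {q : ℕ} : ∀ {V : List ℕ},
    q ∈ addV H R V ↔ q ∈ V ∨ ∃ r ∈ R, r.1 ∈ H ∧ r.2 = q := by
  induction R with
  | nil => simp [addV]
  | cons r R ih =>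
    intro V
    rw [addV, List.foldl_cons, ← addV, ih, List.exists_mem_cons_iff]
    split_ifs with h
    · simp only [List.mem_cons, h, true_and]
      tauto
    · simp [h]

theorem subset_addH {V : List ℕ} : ∀ {H : List ℕ}, H ⊆ addH V T H := by
  induction T with
  | nil => exact fun h => h
  | cons t T ih =>
    intro H p hp
    rw [addH, List.foldl_cons, ← addH]
    refine ih ?_
    rw [stepH]
    split_ifs
    · exact List.mem_cons_of_mem _ hp
    · exact hp

/-- The list of states only grows along the fold, so the source of `t` is still present when `t` is
processed, whatever the order of the transitions. -/
theorem mem_addH_of_mem {V : List ℕ} {t : ℕ × Filt P × ℕ} (ht : t ∈ T) {q : ℕ} (hq : q ∈ V)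
    (hs : sat t.2.1 q) : ∀ {H : List ℕ}, t.1 ∈ H → t.2.2 ∈ addH V T H := by
  induction T with
  | nil => simp at ht
  | cons u T ih =>
    intro H hp
    rw [addH, List.foldl_cons, ← addH]
    rcases List.mem_cons.1 ht with rfl | ht
    · refine subset_addH ?_
      rw [stepH, if_pos ⟨hp, q, hq, hs⟩]
      exact List.mem_cons_self
    · refine ih ht ?_
      rw [stepH]
      split_ifs
      · exact List.mem_cons_of_mem _ hp
      · exact hp

/-- The induction runs over a sublist `U` so that closedness under all of `T` stays available. -/
theorem of_mem_addH {GH GV : ℕ → Prop} (hG : Closed R T GH GV) {V : List ℕ}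
    (hV : ∀ q ∈ V, GV q) {U : List (ℕ × Filt P × ℕ)} (hU : U ⊆ T) : ∀ {H : List ℕ},
      (∀ p ∈ H, GH p) → ∀ p ∈ addH V U H, GH p := by
  induction U with
  | nil => exact fun h => h
  | cons t U ih =>
    intro H hH
    rw [addH, List.foldl_cons, ← addH]
    refine ih (List.subset_of_cons_subset hU) ?_
    rw [stepH]
    split_ifs with h
    · obtain ⟨h₁, q, hq, hs⟩ := h
      exact List.forall_mem_cons.2
        ⟨hG.trans t (hU List.mem_cons_self) (hH _ h₁) q (hV q hq) hs, hH⟩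
    · exact hH

theorem of_mem_round {GH GV : ℕ → Prop} (hG : Closed R T GH GV) {x : List ℕ × List ℕ}
    (hx : (∀ p ∈ x.1, GH p) ∧ ∀ q ∈ x.2, GV q) :
    (∀ p ∈ (round R T x).1, GH p) ∧ ∀ q ∈ (round R T x).2, GV q := by
  have hV : ∀ q ∈ addV x.1 R x.2, GV q := by
    intro q hq
    rcases mem_addV.1 hq with hq | ⟨r, hr, hp, rfl⟩
    · exact hx.2 q hq
    · exact hG.rule r hr (hx.1 _ hp)
  exact ⟨of_mem_addH hG hV (fun _ h => h) hx.1, hV⟩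

/-- Used twice: with the accessible states it gives soundness of saturation, with the targets of
rules and transitions it bounds the number of states found. -/
theorem of_mem_iterate_round {GH GV : ℕ → Prop} (hG : Closed R T GH GV) {x : List ℕ × List ℕ}
    (hx : (∀ p ∈ x.1, GH p) ∧ ∀ q ∈ x.2, GV q) (n : ℕ) :
    (∀ p ∈ ((round R T)^[n] x).1, GH p) ∧ ∀ q ∈ ((round R T)^[n] x).2, GV q := by
  induction n with
  | zero => exact hx
  | succ n ih =>
    rw [Function.iterate_succ_apply']
    exact of_mem_round hG ih

theorem subset_round (x : List ℕ × List ℕ) :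
    x.1 ⊆ (round R T x).1 ∧ x.2 ⊆ (round R T x).2 :=
  ⟨subset_addH, fun _ hq => mem_addV.2 (.inl hq)⟩

/-- The number of states that are known to be accessible. -/
def count (x : List ℕ × List ℕ) : ℕ := x.1.toFinset.card + x.2.toFinset.card

/-- A round that does not increase the count adds no new element to either set, and everything a
rule or transition yields is added in a round. -/
theorem closed_or_count_lt (x : List ℕ × List ℕ) :
    Closed R T (· ∈ x.1) (· ∈ x.2) ∨ count x < count (round R T x) := by
  by_contra! h
  obtain ⟨hc, hle⟩ := h
  have h₁ : x.1.toFinset ⊆ (round R T x).1.toFinset := fun p hp =>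
    List.mem_toFinset.2 ((subset_round x).1 (List.mem_toFinset.1 hp))
  have h₂ : x.2.toFinset ⊆ (round R T x).2.toFinset := fun p hp =>
    List.mem_toFinset.2 ((subset_round x).2 (List.mem_toFinset.1 hp))
  have c₁ := Finset.card_le_card h₁
  have c₂ := Finset.card_le_card h₂
  rw [count, count] at hle
  have e₁ := Finset.eq_of_subset_of_card_le h₁ (by omega)
  have e₂ := Finset.eq_of_subset_of_card_le h₂ (by omega)
  refine hc ⟨fun r hr hp => ?_, fun t ht hp q hq hs => ?_⟩
  · rw [← List.mem_toFinset, e₂, List.mem_toFinset]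
    exact mem_addV.2 (.inr ⟨r, hr, hp, rfl⟩)
  · rw [← List.mem_toFinset, e₁, List.mem_toFinset]
    exact mem_addH_of_mem ht (mem_addV.2 (.inl hq)) hs hp

/-- A round applied to closed sets can only repeat elements, so closedness persists once it is
attained. -/
theorem Closed.round {x : List ℕ × List ℕ} (h : Closed R T (· ∈ x.1) (· ∈ x.2)) :
    Closed R T (· ∈ (round R T x).1) (· ∈ (round R T x).2) := by
  have h₁ := of_mem_round h ⟨fun _ hp => hp, fun _ hq => hq⟩
  have h₂ := subset_round (R := R) (T := T) x
  exact ⟨fun r hr hp => h₂.2 (h.rule r hr (h₁.1 _ hp)),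
    fun t ht hp q hq hs => h₂.1 (h.trans t ht (h₁.1 _ hp) q (h₁.2 q hq) hs)⟩

theorem closed_or_le_count (x : List ℕ × List ℕ) (n : ℕ) :
    Closed R T (· ∈ ((Universality.round R T)^[n] x).1) (· ∈ ((Universality.round R T)^[n] x).2) ∨
      n + count x ≤ count ((Universality.round R T)^[n] x) := by
  induction n with
  | zero => exact .inr (by simp)
  | succ n ih =>
    rw [Function.iterate_succ_apply']
    rcases ih with h | h
    · exact .inl h.round
    · rcases closed_or_count_lt (R := R) (T := T) ((Universality.round R T)^[n] x) with h' | h'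
      · exact .inl h'.round
      · exact .inr (by omega)

/-- Without closedness the count, initially 1, has grown by at least `n`, but only `p₀` and the
targets of transitions and rules can occur. -/
theorem closed_iterate_round (p₀ : ℕ) {n : ℕ} (hn : R.length + T.length < n) :
    Closed R T (· ∈ ((Universality.round R T)^[n] ([p₀], [])).1)
      (· ∈ ((Universality.round R T)^[n] ([p₀], [])).2) := by
  refine (closed_or_le_count ([p₀], []) n).resolve_right fun h => ?_
  -- The initial state and all targets form a closed pair, since every application ends in a target.
  have hG : Closed R T (fun p => p = p₀ ∨ ∃ t ∈ T, t.2.2 = p) (fun q => ∃ r ∈ R, r.2 = q) :=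
    ⟨fun r hr _ => ⟨r, hr, rfl⟩, fun t ht _ _ _ _ => .inr ⟨t, ht, rfl⟩⟩
  have hm := of_mem_iterate_round hG (x := ([p₀], [])) ⟨by simp, by simp⟩ n
  have h₁ : ((Universality.round R T)^[n] ([p₀], [])).1.toFinset ⊆
      (p₀ :: T.map fun t => t.2.2).toFinset := by
    intro p hp
    simpa using hm.1 p (List.mem_toFinset.1 hp)
  have h₂ : ((Universality.round R T)^[n] ([p₀], [])).2.toFinset ⊆ (R.map Prod.snd).toFinset := by
    intro p hp
    simpa using hm.2 p (List.mem_toFinset.1 hp)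
  have c₁ := (Finset.card_le_card h₁).trans (List.toFinset_card_le _)
  have c₂ := (Finset.card_le_card h₂).trans (List.toFinset_card_le _)
  rw [List.length_cons, List.length_map] at c₁
  rw [List.length_map] at c₂
  have c₃ : [p₀].toFinset.card = 1 := by simp
  simp only [count] at h
  omega

end Universality

/-! ### Closed sets of accessible states decide universality -/

namespace AUTC

open Universality

variable {α : Type} {P : Set (Pattern α)} (A : AUTC P)

/-- The vertical rules `(p₀, p) → q`, as pairs `(p, q)`. -/
def rulePairs : List (ℕ × ℕ) := A.aut.rules.map fun r => (r.1.1.2.1, r.2)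

/-- The horizontal transitions, with states as natural numbers. -/
def transTriples : List (ℕ × Filt P × ℕ) := A.H.rules.map fun r => (r.1.1, r.2.1, r.2.2.1)

/-- Together with `of_mem_iterate_round` this shows that saturation only produces accessible states.
-/
theorem closed_accessible : Closed A.rulePairs A.transTriples
    (fun p => ∃ h : p ∈ A.H.states, A.HAccessible ⟨p, h⟩) A.VAccessible := by
  constructor
  · rintro r hr ⟨h, hp⟩
    obtain ⟨r', hr', rfl⟩ := List.mem_map.1 hr
    exact HAccessible.vAccessible hr' hp
  · rintro t ht ⟨h, hp⟩ q hq hs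
    obtain ⟨t', ht', rfl⟩ := List.mem_map.1 ht
    obtain ⟨d, hd⟩ := (sat_eq_true_iff _ _).1 hs
    exact ⟨t'.2.2.2, hp.read hq ⟨t'.2.1, ht', hd⟩⟩

theorem readsAll_iff (p : A.H.State) (q : ℕ) : readsAll A.transTriples p.1 q = true ↔
    ∀ d : List α, ∃ p', A.H.Reads p d {q} p' := by
  rw [readsAll, valid_not_avoid]
  refine forall_congr' fun d => ?_
  constructor
  · rintro ⟨f, hf, hs⟩
    simp only [outFilters, transTriples, List.mem_flatMap, List.mem_map] at hf
    obtain ⟨_, ⟨t, ht, rfl⟩, hf⟩ := hf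
    split_ifs at hf with h
    · rw [List.mem_singleton] at hf
      obtain rfl : t.1 = p := Subtype.ext h
      exact ⟨t.2.2, f, hf ▸ ht, hs⟩
    · simp at hf
  · rintro ⟨p', f, ht, hs⟩
    refine ⟨f, ?_, hs⟩
    simp only [outFilters, transTriples, List.mem_flatMap, List.mem_map]
    exact ⟨_, ⟨_, ht, rfl⟩, by simp⟩

/-- Universality is decided by checking the three conditions on sets of accessible states that are
closed under the rules and transitions. -/
theorem language_eq_univ_iff_of_closed {GH GV : ℕ → Prop}
    (hc : Closed A.rulePairs A.transTriples GH GV) (h₀ : GH A.p₀.1)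
    (hH : ∀ p, GH p → ∃ h : p ∈ A.H.states, A.HAccessible ⟨p, h⟩)
    (hV : ∀ q, GV q → A.VAccessible q) :
    A.language = Set.univ ↔ (∀ q, GV q → q ∈ A.aut.finals) ∧
      ∀ p, GH p → (∃ r ∈ A.rulePairs, r.1 = p) ∧
        ∀ q, GV q → readsAll A.transTriples p q = true := by
  constructor
  · intro hu
    obtain ⟨h₁, h₂, h₃⟩ := A.language_eq_univ_iff.1 hu
    -- The conditions hold for all accessible states, in particular for those in `GH` and `GV`.
    refine ⟨fun q hq => h₁ q (hV q hq), fun p hp => ?_⟩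
    obtain ⟨h, hp⟩ := hH p hp
    refine ⟨?_, fun q hq => (A.readsAll_iff ⟨p, h⟩ q).2 fun d => h₃ _ hp d q (hV q hq)⟩
    obtain ⟨r, hr, he⟩ := h₂ _ hp
    exact ⟨_, List.mem_map_of_mem hr, congrArg Subtype.val he⟩
  · rintro ⟨h₁, h₂⟩
    have key : ∀ M : Arity α, (∀ x ∈ M, ∃ q, GV q ∧ x.2 = {q}) → ∀ p : A.H.State, GH p.1 →
        ∃ p' : A.H.State, GH p'.1 ∧ Relation.ReflTransGen A.H.Step (p, M) (p', 0) := by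
      intro M
      induction M using Multiset.induction_on with
      | empty => exact fun _ p hp => ⟨p, hp, .refl⟩
      | cons x M ih =>
        intro hM p hp
        obtain ⟨q, hq, hx⟩ := hM x (Multiset.mem_cons_self x M)
        obtain ⟨d, Q⟩ := x
        obtain rfl : Q = {q} := hx
        obtain ⟨p', f, ht, hs⟩ := (A.readsAll_iff p q).1 ((h₂ _ hp).2 q hq) d
        -- The data value `d` witnesses satisfiability of the filter, so closedness keeps the run
        -- inside `GH`.
        have hp' : GH p'.1 := hc.trans _ (List.mem_map_of_mem ht) hp q hq
          ((sat_eq_true_iff _ _).2 ⟨d, hs⟩)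
        obtain ⟨p'', hp'', hr⟩ := ih (fun y hy => hM y (Multiset.mem_cons_of_mem hy)) p' hp'
        refine ⟨p'', hp'', .head ?_ hr⟩
        rw [← Multiset.singleton_add, add_comm]
        exact HorAut.Step.read M ⟨f, ht, hs⟩
    have main : ∀ t : Tree α, ∃ q, GV q ∧ q ∈ A.aut.eval t := by
      intro t
      induction t using Tree.induction with
      | h N ih =>
        obtain ⟨p, hp, hs⟩ := key (N.map fun c => (c.1, A.aut.eval c.2)) (by
          intro x hx
          obtain ⟨c, hc, rfl⟩ := Multiset.mem_map.1 hx
          obtain ⟨q, hq, he⟩ := ih c hc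
          exact ⟨q, hq, A.eval_eq_singleton he⟩) A.p₀ h₀
        obtain ⟨⟨r, hr, he⟩, -⟩ := h₂ _ hp
        obtain ⟨r', hr', rfl⟩ := List.mem_map.1 hr
        obtain rfl : r'.1.1.2 = p := Subtype.ext he
        exact ⟨r'.2, hc.rule _ hr hp, (A.mem_eval_node N _).2 ⟨r', hr', rfl, hs⟩⟩
    rw [Set.eq_univ_iff_forall]
    intro t
    obtain ⟨q, hq, he⟩ := main t
    exact ⟨q, he, h₁ q hq⟩

end AUTC

end DataTree

/-! ### The universality test -/

namespace DataTree

open Function StackProg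

namespace Universality

variable {α : Type} {P : Set (Pattern α)} {O : List (Sym α) → Bool → ℕ → Prop} {Q : ℕ → ℕ}

/-- The lists may contain repetitions, so their lengths are not bounded by the number of states.
Linear growth per round still gives a quadratic bound. -/
theorem length_iterate_round {R : List (ℕ × ℕ)} {T : List (ℕ × Filt P × ℕ)} {N : ℕ}
    (hR : (R.flatMap encRule : List (Sym α)).length ≤ N)
    (hT : (T.flatMap encTrans : List (Sym α)).length ≤ N) (x : List ℕ × List ℕ) (k : ℕ) :
    (encNames ((round R T)^[k] x).1 : List (Sym α)).length ≤
      (encNames x.1 : List (Sym α)).length + k * N ∧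
    (encNames ((round R T)^[k] x).2 : List (Sym α)).length ≤
      (encNames x.2 : List (Sym α)).length + k * N := by
  induction k with
  | zero => simp
  | succ k ih =>
    rw [Function.iterate_succ_apply', Nat.add_mul]
    have h₁ := length_encNames_addV (α := α) ((round R T)^[k] x).1 R ((round R T)^[k] x).2
    have h₂ := length_encNames_addH (addV ((round R T)^[k] x).1 R ((round R T)^[k] x).2) T
      ((round R T)^[k] x).1
    simp only [round] at h₁ h₂ ih ⊢
    omega

theorem close_notMem_flatMap {β : Type} {g : β → List (Sym α)} (hg : ∀ r, Sym.close ∉ g r)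
    (L : List β) : Sym.close ∉ L.flatMap g := by
  simp [hg]

/-- The stacks after the input has been read. -/
def parsed (w : List (Sym α)) (F H : List ℕ) (R : List (ℕ × ℕ)) (T : List (ℕ × Filt P × ℕ)) :
    Var → List (Sym α)
  | .cnt => w
  | .fin => encNames F
  | .hs => encNames H
  | .ru => R.flatMap encRule
  | .tr => T.flatMap encTrans
  | _ => []

theorem clean_parsed (w : List (Sym α)) (F H : List ℕ) (R : List (ℕ × ℕ))
    (T : List (ℕ × Filt P × ℕ)) : Clean (parsed w F H R T) := by
  constructor <;> rfl

theorem encode_eq (A : AUTC P) :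
    A.encode = encNames A.aut.states ++ Sym.close :: (encNames A.aut.finals ++ Sym.close ::
      (encNames A.H.states ++ Sym.close :: (A.transTriples.flatMap encTrans ++ Sym.close ::
        (encodeName A.p₀.1 ++ Sym.sep :: (A.rulePairs.flatMap encRule ++ [Sym.close]))))) := by
  have h₁ : A.transTriples.flatMap encTrans = A.H.rules.flatMap
      (fun r => encodeItem r.1.1 ++ r.2.1.encode ++ [Sym.sep] ++ encodeItem r.2.2.1) := by
    rw [AUTC.transTriples, List.flatMap_map]
    rfl
  have h₂ : (A.rulePairs.flatMap encRule : List (Sym α)) =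
      A.aut.rules.flatMap (fun r => encodeItem r.1.1.2.1 ++ encodeItem r.2) := by
    rw [AUTC.rulePairs, List.flatMap_map]
    rfl
  rw [h₁, h₂, AUTC.encode]
  simp [encNames, encodeItem]

theorem language_eq_univ_iff_iterate_round (A : AUTC P) {H V : List ℕ}
    (hHV : (round A.rulePairs A.transTriples)^[A.encode.length] ([A.p₀.1], []) = (H, V)) :
    A.language = Set.univ ↔ ¬ ((∃ q ∈ V, q ∉ A.aut.finals) ∨
      ∃ p ∈ H, ¬ (∃ r ∈ A.rulePairs, r.1 = p) ∨
        ∃ q ∈ V, readsAll A.transTriples p q = false) := by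
  have hl := congrArg List.length (encode_eq A)
  simp only [List.length_append, List.length_cons, List.length_nil] at hl
  have hR := length_le_length_flatMap (g := (encRule : _ → List (Sym α)))
    (by simp [encRule, encodeItem]) A.rulePairs
  have hT := length_le_length_flatMap (g := (encTrans : _ × Filt P × _ → List (Sym α)))
    (by simp [encTrans, encodeItem]) A.transTriples
  -- Every rule and every transition occupies at least one symbol of the input, and there are
  -- further separators, so the input length exceeds their total number.
  have hclosed := closed_iterate_round (R := A.rulePairs) (T := A.transTriples) A.p₀.1
    (n := A.encode.length) (by omega)
  have hacc := of_mem_iterate_round A.closed_accessible (x := ([A.p₀.1], []))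
    ⟨by simpa using ⟨A.p₀.2, A.hAccessible_init⟩, by simp⟩ A.encode.length
  have hsub : ∀ k, A.p₀.1 ∈ ((round A.rulePairs A.transTriples)^[k] ([A.p₀.1], [])).1 := by
    intro k
    induction k with
    | zero => simp
    | succ k ih => rw [Function.iterate_succ_apply']; exact (subset_round _).1 ih
  have huniv := A.language_eq_univ_iff_of_closed hclosed (hsub _) hacc.1 hacc.2
  rw [huniv, hHV]
  push Not
  simp only [ne_eq, Bool.not_eq_false]

variable [DecidableEq (Sym α)]

/-- Move a section of the input to the stack `y`. -/
def readSection (y : Var) : Prog α := .seq (readUntil Sym.close .inp .tmp) (move .tmp y)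

theorem runs_readSection {y : Var} (hy : y ≠ .inp) (hy' : y ≠ .tmp) (S : Var → List (Sym α))
    {w r : List (Sym α)} (hS : S .inp = w ++ Sym.close :: r) (hw : Sym.close ∉ w) {B : ℕ}
    (hB : w.length ≤ B) (htmp : S .tmp = []) (hSy : S y = []) :
    Runs Sym.bit O (readSection y) S (10 * B + 3) (update (update S .inp r) y w) := by
  refine ((runs_readUntil (x := .inp) (y := .tmp) (by simp) S hS hw hB).seq
    (runs_move hy'.symm _ (B := B) ?_)).conv ?_ ?_
  · simpa [htmp]
  · omega
  · funext v
    by_cases h : v = y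
    · subst h; simp [hy, hy', htmp, hSy]
    · by_cases h' : v = .tmp
      · subst h'; simp [h, htmp]
      · simp [h, h']

/-- Split the input into its parts. -/
def parse : Prog α :=
  -- The copy of the input serves as a unary counter for the rounds. The lists of all vertical and
  -- all horizontal states are dropped, as the test does not use them.
  .seq (copy .inp .cnt .tmp) <| .seq (dropUntil Sym.close .inp) <| .seq (readSection .fin) <|
  .seq (dropUntil Sym.close .inp) <| .seq (readSection .tr) <|
  .seq (readUntil Sym.sep .inp .a) <| .seq (.push .hs Sym.sep) <| .seq (move .a .hs) <|
  readSection .ru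

/-- A time bound for `parse`. -/
def parseTime (N : ℕ) : ℕ := 60 * N + 30

theorem runs_parse (L L' F : List ℕ) (p₀ : ℕ) (R : List (ℕ × ℕ)) (T : List (ℕ × Filt P × ℕ))
    {w : List (Sym α)}
    (hw : w = encNames L ++ Sym.close :: (encNames F ++ Sym.close :: (encNames L' ++ Sym.close ::
      (T.flatMap encTrans ++ Sym.close :: (encodeName p₀ ++ Sym.sep ::
        (R.flatMap encRule ++ [Sym.close])))))) :
    Runs Sym.bit O parse (update (fun _ => []) .inp w) (parseTime w.length)
      (parsed w F [p₀] R T) := by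
  have hitem : ∀ n : ℕ, (Sym.close : Sym α) ∉ encodeItem n := by
    intro n; simp [encodeItem, close_notMem_encodeName]
  have hnames : ∀ L : List ℕ, (Sym.close : Sym α) ∉ encNames L := close_notMem_flatMap hitem
  have hR : (Sym.close : Sym α) ∉ R.flatMap encRule :=
    close_notMem_flatMap (by intro r; simp [encRule, hitem]) R
  have hT : (Sym.close : Sym α) ∉ T.flatMap encTrans :=
    close_notMem_flatMap (by intro r; simp [encTrans, hitem, (notMem_encode_filt _).2]) T
  have hl := congrArg List.length hw
  simp only [List.length_append, List.length_cons, List.length_nil] at hl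
  refine ((runs_copy (x := .inp) (y := .cnt) (t := .tmp) (by simp) (update (fun _ => []) .inp w)
    (by simp) (B := w.length) (by simp)).seq
    ((runs_dropUntil (x := .inp) _ (by simp [hw]; rfl) (hnames L) (B := w.length) (by omega)).seq
    ((runs_readSection (y := .fin) (by simp) (by simp) _ (by simp; rfl) (hnames F)
      (B := w.length) (by omega) (by simp) (by simp)).seq
    ((runs_dropUntil (x := .inp) _ (by simp; rfl) (hnames L') (B := w.length) (by omega)).seq
    ((runs_readSection (y := .tr) (by simp) (by simp) _ (by simp; rfl) hT
      (B := w.length) (by omega) (by simp) (by simp)).seq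
    ((runs_readUntil (x := .inp) (y := .a) (by simp) _ (by simp; rfl) (sep_notMem_encodeName p₀)
      (B := w.length) (by omega)).seq
    ((Runs.push .hs Sym.sep _).seq
    ((runs_move (x := .a) (y := .hs) (by simp) _ (B := w.length) ?_).seq
    (runs_readSection (y := .ru) (by simp) (by simp) _ (by simp; rfl) hR
      (B := w.length) (by omega) (by simp) (by simp)))))))))).conv ?_ ?_
  · simp; omega
  · rw [parseTime]; omega
  · funext v
    cases v <;> simp [parsed, encNames, encodeItem]

/-- Decide universality. -/
def universal : Prog α :=
  .seq parse <| .seq saturate <| .seq checkFinal <| .seq checkHor <| .seq (clear .fin) <|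
  .seq (clear .tr) <| .seq (clear .ru) <| .seq (clear .hs) (clear .vs)

/-- A bound for the contents of all stacks. -/
def sizeBound (N : ℕ) : ℕ := N * N + 2 * N

/-- A time bound for `universal`. -/
def universalTime (Q : ℕ → ℕ) (N : ℕ) : ℕ :=
  parseTime N + saturateTime Q N (sizeBound N) + checkFinalTime (sizeBound N) +
    checkHorTime Q (sizeBound N) + 20 * sizeBound N + 5

open Classical in
theorem runs_universal_of (hO : IsOracle P O Q) (L L' F : List ℕ) (p₀ : ℕ) (R : List (ℕ × ℕ))
    (T : List (ℕ × Filt P × ℕ)) {w : List (Sym α)}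
    (hw : w = encNames L ++ Sym.close :: (encNames F ++ Sym.close :: (encNames L' ++ Sym.close ::
      (T.flatMap encTrans ++ Sym.close :: (encodeName p₀ ++ Sym.sep ::
        (R.flatMap encRule ++ [Sym.close])))))) {H V : List ℕ}
    (hHV : (round R T)^[w.length] ([p₀], []) = (H, V)) :
    Runs Sym.bit O universal (update (fun _ => []) .inp w) (universalTime Q w.length)
      (update (fun _ => []) .bad (flag (decide (∃ q ∈ V, q ∉ F) ||
        decide (∃ p ∈ H, ¬ (∃ r ∈ R, r.1 = p) ∨ ∃ q ∈ V, readsAll T p q = false)))) := by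
  have hl := congrArg List.length hw
  simp only [List.length_append, List.length_cons, List.length_nil] at hl
  have hlen := length_iterate_round (R := R) (T := T) (N := w.length) (by omega) (by omega)
    ([p₀], []) w.length
  have h₀ : (encNames [p₀] : List (Sym α)).length = (encodeName p₀ : List (Sym α)).length + 1 := by
    simp [encNames, encodeItem]
  have h₀' : (encNames [] : List (Sym α)).length = 0 := rfl
  simp only [hHV, h₀, h₀'] at hlen
  have hsize : sizeBound w.length = w.length * w.length + 2 * w.length := rfl
  have hclean := clean_parsed w F [p₀] R T
  have h₂ := runs_saturate hO hclean (H := [p₀]) (V := []) (N := w.length)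
    (B := sizeBound w.length) rfl rfl rfl rfl rfl (by simp only [parsed]; omega)
    (by simp only [parsed]; omega) (by simp only [parsed]; omega)
    (by simp only [parsed, List.length_nil]; omega)
  rw [hHV] at h₂
  have hst : update (update (update (parsed w F [p₀] R T) .cnt []) .hs (encNames H)) .vs
      (encNames V) = update (parsed [] F H R T) .vs (encNames V) := by
    funext v
    cases v <;> simp [parsed]
  simp only [hst] at h₂
  have hclean' : ∀ b : List (Sym α),
      Clean (update (update (parsed [] F H R T) .vs (encNames V)) .bad b) := by
    intro b
    obtain ⟨_, _, _, _, _, _, _, _, _, _, _, _, _, _⟩ := clean_parsed ([] : List (Sym α)) F H R T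
    constructor <;> simpa
  have hbad : update (update (parsed [] F H R T) .vs (encNames V)) .bad [] =
      (update (parsed [] F H R T) .vs (encNames V) : Var → List (Sym α)) := by
    funext v
    cases v <;> simp [parsed]
  have h₃ := runs_checkFinal (O := O) (hclean' []) (F := F) (V := V) (h := false)
    (B := sizeBound w.length) (by simp [parsed]) (by simp [parsed]; omega) (by simp)
    (by simp; omega) (by simp)
  simp only [Bool.false_or, update_idem] at h₃
  rw [hbad] at h₃
  have h₄ := runs_checkHor hO (hclean' (flag (decide (∃ q ∈ V, q ∉ F))))
    (R := R) (T := T) (H := H) (V := V) (B := sizeBound w.length) (by simp [parsed])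
    (by simp [parsed] at hl ⊢; omega) (by simp [parsed]) (by simp [parsed] at hl ⊢; omega)
    (by simp [parsed]) (by simp [parsed]; omega) (by simp) (by simp; omega)
    (update_self _ _ _)
  -- The final clearing leaves only `bad` possibly nonempty, as required by
  -- `nonempty_computableInPolyTime`.
  refine ((runs_parse L L' F p₀ R T hw).seq (h₂.seq (h₃.seq (h₄.seq
    ((runs_clear .fin _ (B := sizeBound w.length) ?_).seq
    ((runs_clear .tr _ (B := sizeBound w.length) ?_).seq
    ((runs_clear .ru _ (B := sizeBound w.length) ?_).seq
    ((runs_clear .hs _ (B := sizeBound w.length) ?_).seq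
    (runs_clear .vs _ (B := sizeBound w.length) ?_))))))))).conv ?_ ?_
  · simp [parsed]; omega
  · simp [parsed] at hl ⊢; omega
  · simp [parsed] at hl ⊢; omega
  · simp [parsed]; omega
  · simp; omega
  · rw [universalTime]
    omega
  · funext v
    cases v <;> simp [parsed]

open Classical in
theorem runs_universal (hO : IsOracle P O Q) (A : AUTC P) :
    Runs Sym.bit O universal (update (fun _ => []) .inp A.encode)
      (universalTime Q A.encode.length)
      (update (fun _ => []) .bad (if decide (A.language = Set.univ) then [] else [Sym.sep])) := by
  have h := runs_universal_of hO _ _ _ _ _ _ (encode_eq A) rfl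
  have hiff := language_eq_univ_iff_iterate_round A rfl
  rw [← Bool.decide_or] at h
  by_cases hA : A.language = Set.univ
  · rw [decide_eq_false (hiff.1 hA), flag_false] at h
    simpa [hA] using h
  · rw [decide_eq_true (by rwa [hiff, not_not] at hA), flag_true] at h
    simpa [hA] using h

/-! ### Polynomiality of the time bound -/

/-- Functions that are given by polynomials. -/
def IsPoly (f : ℕ → ℕ) : Prop := ∃ p : Polynomial ℕ, ∀ n, f n = p.eval n

theorem IsPoly.const (c : ℕ) : IsPoly fun _ => c := ⟨Polynomial.C c, by simp⟩

theorem IsPoly.id : IsPoly fun n => n := ⟨Polynomial.X, by simp⟩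

theorem IsPoly.add {f g : ℕ → ℕ} (hf : IsPoly f) (hg : IsPoly g) : IsPoly fun n => f n + g n :=
  let ⟨p, hp⟩ := hf
  let ⟨q, hq⟩ := hg
  ⟨p + q, by simp [hp, hq]⟩

theorem IsPoly.mul {f g : ℕ → ℕ} (hf : IsPoly f) (hg : IsPoly g) : IsPoly fun n => f n * g n :=
  let ⟨p, hp⟩ := hf
  let ⟨q, hq⟩ := hg
  ⟨p * q, by simp [hp, hq]⟩

theorem IsPoly.eval (p : Polynomial ℕ) {f : ℕ → ℕ} (hf : IsPoly f) : IsPoly fun n => p.eval (f n) :=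
  let ⟨q, hq⟩ := hf
  ⟨p.comp q, by simp [hq]⟩

/-- All bounds are composed of constants, sums, products and evaluations of `p`. The argument of
`universalTime` is the cost of a call with a query of length `n`. -/
theorem isPoly_universalTime (p : Polynomial ℕ) :
    IsPoly (universalTime fun n => n + p.eval n + 2) := by
  unfold universalTime parseTime saturateTime ruleStepTime ruleBodyTime transStepTime transBodyTime
    checkFinalTime checkHorTime checkReadTime readBodyTime collectTime collectBodyTime
    satQueriesTime satQueryTime forNamesTime lookupTime compareTime sizeBound
  repeat' first
    | exact IsPoly.id
    | exact IsPoly.const _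
    | apply IsPoly.add
    | apply IsPoly.mul
    | apply IsPoly.eval

/-- Coefficients in ℕ are nonnegative. Monotonicity matters because the lengths of queries are only
bounded from above. -/
theorem monotone_eval (p : Polynomial ℕ) : Monotone fun n => p.eval n := by
  intro m n h
  simp only [Polynomial.eval_eq_sum_range]
  gcongr

end Universality

theorem finite_sym (α : Type) [Finite α] : Finite (Sym α) := by
  refine Finite.of_surjective (fun x : Bool ⊕ α ⊕ Fin 9 => match x with
    | .inl b => Sym.bit b
    | .inr (.inl a) => Sym.letter a
    | .inr (.inr 0) => Sym.word
    | .inr (.inr 1) => Sym.cat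
    | .inr (.inr 2) => Sym.alt
    | .inr (.inr 3) => Sym.star
    | .inr (.inr 4) => Sym.state
    | .inr (.inr 5) => Sym.and
    | .inr (.inr 6) => Sym.not
    | .inr (.inr 7) => Sym.sep
    | .inr (.inr 8) => Sym.close) ?_
  rintro (b | a | _)
  exacts [⟨.inl b, rfl⟩, ⟨.inr (.inl a), rfl⟩, ⟨.inr (.inr 0), rfl⟩, ⟨.inr (.inr 1), rfl⟩,
    ⟨.inr (.inr 2), rfl⟩, ⟨.inr (.inr 3), rfl⟩, ⟨.inr (.inr 4), rfl⟩, ⟨.inr (.inr 5), rfl⟩,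
    ⟨.inr (.inr 6), rfl⟩, ⟨.inr (.inr 7), rfl⟩, ⟨.inr (.inr 8), rfl⟩]

open Universality in
theorem decidableInPTime_universal {α : Type} [Fintype α] (P : Set (Pattern α))
    (hP : DecidableInPTime (Filt.encode (P := P)) (fun f : Filt P => f.SingletonValid)) :
    DecidableInPTime (AUTC.encode (P := P)) (fun A : AUTC P => A.language = Set.univ) := by
  classical
  obtain ⟨h⟩ := hP
  have := finite_sym α
  obtain ⟨T, hT⟩ := isPoly_universalTime h.time
  refine nonempty_computableInPolyTime h Sym.bit universal .inp .bad Sym.sep T ?_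
  intro O hO A
  have hO' : IsOracle P O (fun n => n + h.time.eval n + 2) :=
    ⟨fun m n hmn => by have := monotone_eval h.time hmn; dsimp only at this ⊢; omega, hO⟩
  rw [← hT]
  exact runs_universal hO' A

end DataTree

theorem mainTheorem3 {α : Type} [Fintype α] (P : Set (DataTree.Pattern α))
    (hP : DataTree.DecidableInPTime (DataTree.Filt.encode (P := P))
      (fun f : DataTree.Filt P => f.SingletonValid)) :
    DataTree.DecidableInPTime (DataTree.AUTC.encode (P := P))
      (fun A : DataTree.AUTC P => A.language = Set.univ) ∧
    ∀ A : DataTree.AUTC P, A.language = Set.univ ↔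
      (∀ q : ℕ, A.VAccessible q → q ∈ A.aut.finals) ∧
      (∀ p : A.H.State, A.HAccessible p → A.HAccepting p) ∧
      (∀ p : A.H.State, A.HAccessible p → ∀ (d : List α) (q : ℕ), A.VAccessible q →
        ∃ p' : A.H.State, A.H.Reads p d {q} p') :=
  ⟨DataTree.decidableInPTime_universal P hP, fun A => A.language_eq_univ_iff⟩
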